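/- **Notation.** A subgroup $F$ of a group $X$ is *finitely separable* if for every $g\in X\setminus F$ there is a homomorphism $\psi$ of $X$ onto a finite group with $g\psi\notin F\psi$. It is *separable by* a family $\Psi$ of normal subgroups of $X$ if $\bigcap_{N\in\Psi}FN=F$. The family $\Psi$ is a *$Y$-filtration*, where $Y\leqslant X$, if $\bigcap_{N\in\Psi}N=1$ and $Y$ is separable by $\Psi$. Let $A$, $B$ be groups, $H\leqslant A$, $K\leqslant B$, and let $\varphi:H\to K$ be an isomorphism. $\Omega$ is the family of all pairs $(R,S)$ of normal subgroups of finite index $R\leqslant A$, $S\leqslant B$ with $(R\cap H)\varphi=S\cap K$; $\Omega_A$ and $\Omega_B$ are its projections onto $A$ and $B$. $\Lambda_A$ (resp. $\Lambda_B$) is the family of all cyclic subgroups of $A$ (resp. $B$) that are not separable by $\Omega_A$ (resp. $\Omega_B$). Consider, for the amalgamated free product $G=(A*B;\,H=K,\varphi)$, the two statements (h) $\Omega_A$ is an $H$-filtration and $\Omega_B$ is a $K$-filtration; (c) every cyclic subgroup of $G$ that is not conjugate in $G$ to (the image in $G$ of) any subgroup in $\Lambda_A\cup\Lambda_B$ is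 finitely separable in $G$. **Theorem 2.1.** Let $A$ be the free group on $a,b$, let $B$ be the free group on $c,d$, let $H=\langle a,\,b^{-1}ab\rangle\leqslant A$ and $K=\langle c,\,d^{-1}c^2d\rangle\leqslant B$, and let $\varphi:H\to K$ be the isomorphism with $a\mapsto c$, $b^{-1}ab\mapsto d^{-1}c^2d$. Let $G=\langle a,b,c,d;\ a=c,\ b^{-1}ab=d^{-1}c^2d\rangle$. Then: 1. $G$ is the free product of $A$ and $B$ with $H$ and $K$ amalgamated according to $\varphi$, with the natural maps $A\to G$, $B\to G$. 2. Every cyclic subgroup of $G$ that is not conjugate in $G$ to any subgroup in $\Lambda_A\cup\Lambda_B$ is finitely separable in $G$. 3. $\Lambda_A$ and $\Lambda_B$ are nonempty: $\Lambda_A$ consists exactly of the conjugates in $A$ of the subgroups $\langle a^{2k}\rangle$, and $\Lambda_B$ exactly of the conjugates in $B$ of the subgroups $\langle c^{2k}\rangle$, where $k$ runs over the nonzero integers. 4. $\Omega_B$ is not a $K$-filtration. Consequently (h) is not a necessary condition for (c): it is not true that (c) implies (h) for all $A$, $B$, $H$, $K$, $\varphi$. -/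

import Mathlib

namespace CycSep

universe u v

/-! Separability of subgroups -/

/-- `F` is finitely separable in `G`: every element outside `F` can be kept outside the image of
`F` by a homomorphism of `G` onto a finite group. -/
def FinitelySeparable {G : Type u} [Group G] (F : Subgroup G) : Prop :=
  ∀ g : G, g ∉ F → ∃ (X : Type u) (_ : Group X) (_ : Finite X) (ψ : G →* X),
    Function.Surjective ψ ∧ ψ g ∉ F.map ψ

open scoped Pointwise in
/-- `F` is separable by the family `Ψ` of (normal) subgroups: the intersection of the sets `F N`,
`N ∈ Ψ`, is `F`. -/
def SeparableBy {G : Type u} [Group G] (Ψ : Set (Subgroup G)) (F : Subgroup G) : Prop :=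
  (⋂ N ∈ Ψ, (F : Set G) * (N : Set G)) = (F : Set G)

/-- The family `Ψ` of (normal) subgroups of `X` is a `Y`-filtration. -/
def IsFiltrationFor {X : Type u} [Group X] (Ψ : Set (Subgroup X)) (Y : Subgroup X) : Prop :=
  sInf Ψ = ⊥ ∧ SeparableBy Ψ Y

/-- The subgroups `F` and `E` of `G` are conjugate in `G`: `F = g E g⁻¹` for some `g`. -/
def ConjSubgroups {G : Type u} [Group G] (F E : Subgroup G) : Prop :=
  ∃ g : G, F = E.map (MulAut.conj g).toMonoidHom

/-! Compatible pairs of subgroups, for an isomorphism `φ : H ≃* K` of subgroups of `A` and `B` -/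

section Families

variable {A : Type u} {B : Type v} [Group A] [Group B] {H : Subgroup A} {K : Subgroup B}

/-- `R ≤ A` and `S ≤ B` are `(H, K, φ)`-compatible: `φ` maps `R ∩ H` onto `S ∩ K`. -/
def Compatible (φ : H ≃* K) (R : Subgroup A) (S : Subgroup B) : Prop :=
  (R.subgroupOf H).map φ.toMonoidHom = S.subgroupOf K

/-- The pairs of compatible normal subgroups of finite index. -/
def Omega (φ : H ≃* K) : Set (Subgroup A × Subgroup B) :=
  {p | p.1.Normal ∧ p.2.Normal ∧ p.1.FiniteIndex ∧ p.2.FiniteIndex ∧ Compatible φ p.1 p.2}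

/-- The projection of `Omega φ` onto `A`. -/
def OmegaA (φ : H ≃* K) : Set (Subgroup A) := Prod.fst '' Omega φ

/-- The projection of `Omega φ` onto `B`. -/
def OmegaB (φ : H ≃* K) : Set (Subgroup B) := Prod.snd '' Omega φ

/-- The cyclic subgroups of `A` that are not separable by `OmegaA φ`. -/
def LambdaA (φ : H ≃* K) : Set (Subgroup A) := {F | IsCyclic F ∧ ¬ SeparableBy (OmegaA φ) F}

/-- The cyclic subgroups of `B` that are not separable by `OmegaB φ`. -/
def LambdaB (φ : H ≃* K) : Set (Subgroup B) := {F | IsCyclic F ∧ ¬ SeparableBy (OmegaB φ) F}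

/-- For a group `G` with homomorphisms `i : A → G`, `j : B → G` (for an amalgamated product, the
embeddings of the factors): every cyclic subgroup of `G` that is conjugate in `G` to no subgroup
of `LambdaA φ ∪ LambdaB φ` is finitely separable in `G`. -/
def CyclicSeparableOutsideLambda (φ : H ≃* K) {G : Type*} [Group G] (i : A →* G) (j : B →* G) :
    Prop :=
  ∀ F : Subgroup G, IsCyclic F →
    (∀ E ∈ Subgroup.map i '' LambdaA φ ∪ Subgroup.map j '' LambdaB φ, ¬ ConjSubgroups F E) →
    FinitelySeparable F

/-- The normal subgroup of `A * B` generated by the elements `h (φ h)⁻¹`, `h ∈ H`. -/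
def amalgamKernel (φ : H ≃* K) : Subgroup (Monoid.Coprod A B) :=
  Subgroup.normalClosure (Set.range fun h : H =>
    (Monoid.Coprod.inl (h : A) * (Monoid.Coprod.inr (φ h : B))⁻¹ : Monoid.Coprod A B))

instance (φ : H ≃* K) : (amalgamKernel φ).Normal := Subgroup.normalClosure_normal

/-- The free product `(A * B; H = K, φ)` of `A` and `B` with amalgamated subgroups. -/
abbrev Amalgam (φ : H ≃* K) : Type (max u v) := Monoid.Coprod A B ⧸ amalgamKernel φ

/-- The canonical map of the first factor to the amalgamated product. -/
def Amalgam.inl (φ : H ≃* K) : A →* Amalgam φ :=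
  (QuotientGroup.mk' (amalgamKernel φ)).comp Monoid.Coprod.inl

/-- The canonical map of the second factor to the amalgamated product. -/
def Amalgam.inr (φ : H ≃* K) : B →* Amalgam φ :=
  (QuotientGroup.mk' (amalgamKernel φ)).comp Monoid.Coprod.inr

end Families

/-! The example -/

/-- The free group with free generators `a`, `b`. -/
abbrev A : Type := FreeGroup (Fin 2)

/-- The free group with free generators `c`, `d`. -/
abbrev B : Type := FreeGroup (Fin 2)

def a : A := FreeGroup.of 0
def b : A := FreeGroup.of 1
def c : B := FreeGroup.of 0
def d : B := FreeGroup.of 1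

/-- The subgroup of `A` generated by `a` and `b⁻¹ a b`. -/
def H : Subgroup A := Subgroup.closure {a, b⁻¹ * a * b}

/-- The subgroup of `B` generated by `c` and `d⁻¹ c² d`. -/
def K : Subgroup B := Subgroup.closure {c, d⁻¹ * c ^ 2 * d}

/-! The indicated generators of `H` and `K` are free generators. -/

theorem lift_pow_injective {ι : Type*} [DecidableEq ι] (m : ι → ℕ) (hm : ∀ i, m i ≠ 0) :
    Function.Injective (FreeGroup.lift fun i => (FreeGroup.of i) ^ m i :
      FreeGroup ι →* FreeGroup ι) := by
  have key : ∀ L : List (ι × Bool),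
      (FreeGroup.lift fun i => (FreeGroup.of i) ^ m i : FreeGroup ι →* FreeGroup ι)
        (FreeGroup.mk L) = FreeGroup.mk (L.flatMap fun x => List.replicate (m x.1) x) := by
    intro L
    induction L with
    | nil => rfl
    | cons x L ih =>
      rw [FreeGroup.lift_mk] at ih ⊢
      rw [List.map_cons, List.prod_cons, ih, List.flatMap_cons, ← FreeGroup.mul_mk]
      congr 1
      obtain ⟨i, s⟩ := x
      have h : ∀ n : ℕ, (FreeGroup.mk [(i, s)]) ^ n = FreeGroup.mk (List.replicate n (i, s)) := by
        intro n
        induction n with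
        | zero => rfl
        | succ n ihn => rw [pow_succ', ihn, FreeGroup.mul_mk, List.replicate_succ]; rfl
      rw [← h]
      cases s
      · change ((FreeGroup.of i) ^ m i)⁻¹ = _
        rw [← inv_pow]
        rfl
      · rfl
  rw [injective_iff_map_eq_one]
  intro w hw
  have hred : ∀ L : List (ι × Bool), FreeGroup.IsReduced L →
      FreeGroup.IsReduced (L.flatMap fun x => List.replicate (m x.1) x) ∧
      (L.flatMap fun x => List.replicate (m x.1) x).head? = L.head? := by
    intro L
    induction L with
    | nil => intro _; exact ⟨FreeGroup.IsReduced.nil, rfl⟩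
    | cons x L ih =>
      intro hL
      have hL' : FreeGroup.IsReduced L := hL.infix ⟨[x], [], by simp⟩
      obtain ⟨h1, h2⟩ := ih hL'
      obtain ⟨n, hn⟩ := Nat.exists_eq_succ_of_ne_zero (hm x.1)
      refine ⟨?_, by rw [List.flatMap_cons, hn, List.replicate_succ]; rfl⟩
      rw [List.flatMap_cons]
      unfold FreeGroup.IsReduced
      rw [List.isChain_append]
      refine ⟨List.isChain_replicate_of_rel _ (fun _ => rfl), h1, ?_⟩
      intro y hy z hz
      rw [h2] at hz
      have hyx : y = x := by
        have := List.mem_of_getLast? hy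
        exact List.eq_of_mem_replicate this
      subst hyx
      cases L with
      | nil => simp at hz
      | cons z' L =>
        simp only [List.head?_cons, Option.mem_def, Option.some.injEq] at hz
        subst hz
        exact (FreeGroup.isReduced_cons_cons.1 hL).1
  have hw' := key w.toWord
  rw [FreeGroup.mk_toWord, hw] at hw'
  obtain ⟨h1, h2⟩ := hred w.toWord FreeGroup.isReduced_toWord
  have h3 := congrArg FreeGroup.toWord hw'
  rw [FreeGroup.toWord_one, FreeGroup.toWord_mk, h1.reduce_eq] at h3
  rw [← h3] at h2
  rw [← FreeGroup.toWord_eq_nil_iff]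
  exact List.head?_eq_none_iff.1 h2.symm

theorem lift_conj_pow_injective (n : ℕ) (hn : n ≠ 0) :
    Function.Injective (FreeGroup.lift
      ![FreeGroup.of 0, (FreeGroup.of 1)⁻¹ * (FreeGroup.of 0) ^ n * FreeGroup.of 1] :
      FreeGroup (Fin 2) →* FreeGroup (Fin 2)) := by
  let σ : Multiplicative ℤ →* MulAut (FreeGroup ℤ) :=
    zpowersHom _ (FreeGroup.freeGroupCongr (Equiv.addRight (1 : ℤ)))
  let ψ : FreeGroup (Fin 2) →* FreeGroup ℤ ⋊[σ] Multiplicative ℤ :=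
    FreeGroup.lift ![SemidirectProduct.inl (FreeGroup.of 0),
      SemidirectProduct.inr (Multiplicative.ofAdd 1)]
  let e : Fin 2 → ℤ := ![0, -1]
  have he : Function.Injective e := by
    intro i j h
    fin_cases i <;> fin_cases j <;> simp_all [e]
  let γ : FreeGroup (Fin 2) →* FreeGroup ℤ :=
    (FreeGroup.map e).comp (FreeGroup.lift fun i => (FreeGroup.of i) ^ (![1, n] i))
  have hγ : Function.Injective γ := by
    refine (FreeGroup.map_injective he).comp (lift_pow_injective _ ?_)
    intro i
    fin_cases i <;> simp [hn]
  have hcomp : ψ.comp (FreeGroup.lift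
      ![FreeGroup.of 0, (FreeGroup.of 1)⁻¹ * (FreeGroup.of 0) ^ n * FreeGroup.of 1]) =
      SemidirectProduct.inl.comp γ := by
    ext1 i
    fin_cases i
    · simp [ψ, γ, e]
    · have h : (σ (Multiplicative.ofAdd 1))⁻¹ (FreeGroup.of 0) = FreeGroup.of (-1) := by
        rw [MulAut.inv_apply, MulEquiv.symm_apply_eq]
        simp [σ]
      have h' := SemidirectProduct.inl_aut_inv (φ := σ) (Multiplicative.ofAdd 1)
        ((FreeGroup.of 0) ^ n)
      rw [map_pow, h] at h'
      simpa [ψ, γ, e] using h'.symm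
  have hinj : Function.Injective (ψ.comp (FreeGroup.lift
      ![FreeGroup.of 0, (FreeGroup.of 1)⁻¹ * (FreeGroup.of 0) ^ n * FreeGroup.of 1])) := by
    rw [hcomp]
    exact SemidirectProduct.inl_injective.comp hγ
  exact Function.Injective.of_comp hinj

/-- The homomorphism of a free group of rank two onto `H` taking its free generators to `a` and
`b⁻¹ a b`. -/
def toH : FreeGroup (Fin 2) →* A := FreeGroup.lift ![a, b⁻¹ * a * b]

/-- The homomorphism of a free group of rank two onto `K` taking its free generators to `c` and
`d⁻¹ c² d`. -/
def toK : FreeGroup (Fin 2) →* B := FreeGroup.lift ![c, d⁻¹ * c ^ 2 * d]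

theorem toH_injective : Function.Injective toH := by
  have h := lift_conj_pow_injective 1 one_ne_zero
  rw [pow_one] at h
  exact h

theorem toK_injective : Function.Injective toK := lift_conj_pow_injective 2 two_ne_zero

theorem range_toH : toH.range = H := by
  rw [toH, FreeGroup.range_lift_eq_closure, Matrix.range_cons, Matrix.range_cons,
    Matrix.range_empty, Set.union_empty]
  rfl

theorem range_toK : toK.range = K := by
  rw [toK, FreeGroup.range_lift_eq_closure, Matrix.range_cons, Matrix.range_cons,
    Matrix.range_empty, Set.union_empty]
  rfl

/-- The isomorphism `H ≃* K` with `a ↦ c` and `b⁻¹ a b ↦ d⁻¹ c² d`. -/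
noncomputable def φ : H ≃* K :=
  (MulEquiv.subgroupCongr range_toH).symm.trans
    ((MonoidHom.ofInjective toH_injective).symm.trans
      ((MonoidHom.ofInjective toK_injective).trans (MulEquiv.subgroupCongr range_toK)))

theorem φ_toH (w : FreeGroup (Fin 2)) (hw : toH w ∈ H) : (φ ⟨toH w, hw⟩ : B) = toK w := by
  have h : (MonoidHom.ofInjective toH_injective).symm
      ((MulEquiv.subgroupCongr range_toH).symm ⟨toH w, hw⟩) = w := by
    rw [MulEquiv.symm_apply_eq]
    rfl
  change toK ((MonoidHom.ofInjective toH_injective).symm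
      ((MulEquiv.subgroupCongr range_toH).symm ⟨toH w, hw⟩)) = toK w
  rw [h]

/-- `φ` does what it should on the generators. -/
theorem φ_generators (h₀ : a ∈ H) (h₁ : b⁻¹ * a * b ∈ H) :
    (φ ⟨a, h₀⟩ : B) = c ∧ (φ ⟨b⁻¹ * a * b, h₁⟩ : B) = d⁻¹ * c ^ 2 * d := by
  have e₀ : toH (FreeGroup.of 0) = a := by simp [toH]
  have e₁ : toH (FreeGroup.of 1) = b⁻¹ * a * b := by simp [toH]
  have f₀ : toK (FreeGroup.of 0) = c := by simp [toK]
  have f₁ : toK (FreeGroup.of 1) = d⁻¹ * c ^ 2 * d := by simp [toK]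
  constructor
  · have h := φ_toH (FreeGroup.of 0) (e₀ ▸ h₀)
    simp only [e₀, f₀] at h
    exact h
  · have h := φ_toH (FreeGroup.of 1) (e₁ ▸ h₁)
    simp only [e₁, f₁] at h
    exact h

/-- The generators of the presentation. -/
inductive Gen : Type
  | a | b | c | d

/-- The relators of the presentation `a = c`, `b⁻¹ a b = d⁻¹ c² d`. -/
def relators : Set (FreeGroup Gen) :=
  {FreeGroup.of Gen.a * (FreeGroup.of Gen.c)⁻¹,
   ((FreeGroup.of Gen.b)⁻¹ * FreeGroup.of Gen.a * FreeGroup.of Gen.b) *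
    ((FreeGroup.of Gen.d)⁻¹ * FreeGroup.of Gen.c ^ 2 * FreeGroup.of Gen.d)⁻¹}

/-- `G = ⟨a, b, c, d; a = c, b⁻¹ a b = d⁻¹ c² d⟩`. -/
abbrev G : Type := PresentedGroup relators

/-- The natural map `A → G`, `a ↦ a`, `b ↦ b`. -/
def ιA : A →* G := FreeGroup.lift ![PresentedGroup.of Gen.a, PresentedGroup.of Gen.b]

/-- The natural map `B → G`, `c ↦ c`, `d ↦ d`. -/
def ιB : B →* G := FreeGroup.lift ![PresentedGroup.of Gen.c, PresentedGroup.of Gen.d]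

end CycSep

open CycSep

/-! Eliminating `c` and putting `t = b d⁻¹` turns the two relations into the single relation `t⁻¹ a
t = a²`. So `G` is the free product of the Baumslag–Solitar group `BS` and the infinite cyclic group
generated by `d`. That product is realised as `FreeWreath BS`, a free group extended by `BS`, in
which words and lengths can be computed (`wreathEquiv`).

In a finite quotient of `BS` the element `a` is conjugate to its square, so it has odd order, and
`⟨a^(2k)⟩` cannot be separated from `a^k`. The same halving works for every compatible pair `(R, S)`
(`exists_odd_pow_mem`). It yields the nonseparable subgroups in `LambdaA φ` and `LambdaB φ`, and it
puts `d⁻¹ c d`, which is not in `K`, into `K S` for every `S` in `OmegaB φ`.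

Nothing else obstructs separability. An element of `FreeWreath BS` is conjugate either into `BS` or
to one whose powers grow linearly in length (`exists_conj_straight`). In the second case a suitable
finite quotient of `BS` reduces the question to a virtually free group
(`Straight.proClosed_zpowers`). In `BS`, elements with nonzero exponent sum of `t` generate closed
subgroups (`BS.proClosed_zpowers`); all others are conjugates of powers of `a`, and since `a^k` is
conjugate to `a^(2k)` these are accounted for by `LambdaA φ`. Inside `A` and `B`, the finer
statement that odd powers of `a` remain separable uses the actions of `BS` on `ZMod n`, `n` odd. -/

namespace CycSep

/-! ### Closed sets and closed cyclic subgroups in the profinite topology. -/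

section ProClosed

variable {Γ Δ : Type*} [Group Γ] [Group Δ]

/-- `S` is closed in the profinite topology of `Γ`. -/
def ProClosed (S : Set Γ) : Prop :=
  ∀ g, g ∉ S → ∃ N : Subgroup Γ, N.Normal ∧ N.FiniteIndex ∧ ∀ s ∈ S, s⁻¹ * g ∉ N

theorem proClosed_of_finiteIndex {S : Set Γ}
    (h : ∀ g, g ∉ S → ∃ N : Subgroup Γ, N.FiniteIndex ∧ ∀ s ∈ S, s⁻¹ * g ∉ N) :
    ProClosed S := by
  intro g hg
  obtain ⟨N, hN, h⟩ := h g hg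
  exact ⟨N.normalCore, inferInstance, inferInstance,
    fun s hs hm => h s hs (N.normalCore_le hm)⟩

theorem finiteIndex_comap (N : Subgroup Δ) [N.FiniteIndex] (f : Γ →* Δ) :
    (N.comap f).FiniteIndex := by
  refine ⟨?_⟩
  rw [Subgroup.index_comap]
  exact (Subgroup.isFiniteRelIndex_of_finiteIndex).relIndex_ne_zero

theorem ProClosed.preimage {S : Set Δ} (hS : ProClosed S) (f : Γ →* Δ) :
    ProClosed (f ⁻¹' S) := by
  intro g hg
  obtain ⟨N, _, hN, h⟩ := hS (f g) hg
  refine ⟨N.comap f, inferInstance, finiteIndex_comap N f, fun s hs hm => h (f s) hs ?_⟩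
  simpa using hm

theorem ProClosed.empty : ProClosed (∅ : Set Γ) :=
  fun _ _ => ⟨⊤, inferInstance, inferInstance, fun _ h => h.elim⟩

theorem ProClosed.union {S T : Set Γ} (hS : ProClosed S) (hT : ProClosed T) :
    ProClosed (S ∪ T) := by
  intro g hg
  obtain ⟨N, _, _, hN⟩ := hS g fun h => hg (Or.inl h)
  obtain ⟨N', _, _, hN'⟩ := hT g fun h => hg (Or.inr h)
  refine ⟨N ⊓ N', inferInstance, inferInstance, ?_⟩
  rintro s (hs | hs) hm
  · exact hN s hs hm.1
  · exact hN' s hs hm.2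

theorem ProClosed.biUnion {ι : Type*} (s : Finset ι) {S : ι → Set Γ}
    (hS : ∀ i ∈ s, ProClosed (S i)) : ProClosed (⋃ i ∈ s, S i) := by
  classical
  induction s using Finset.induction_on with
  | empty => simpa using ProClosed.empty
  | insert i s _ ih =>
    rw [Finset.set_biUnion_insert]
    exact (hS i (Finset.mem_insert_self i s)).union
      (ih fun j hj => hS j (Finset.mem_insert_of_mem hj))

theorem ProClosed.mul_left {S : Set Γ} (hS : ProClosed S) (x : Γ) :
    ProClosed ((fun y => x * y) '' S) := by
  intro g hg
  obtain ⟨N, h₁, h₂, h⟩ := hS (x⁻¹ * g) fun h => hg ⟨_, h, by simp⟩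
  refine ⟨N, h₁, h₂, ?_⟩
  rintro _ ⟨s, hs, rfl⟩ hm
  exact h s hs (by simpa [mul_assoc] using hm)

/-- A subgroup of finite index in the range has finite index in `Δ`, and points outside the range
are separated by the range itself. -/
theorem ProClosed.image {S : Set Γ} (hS : ProClosed S) (i : Γ →* Δ)
    (hi : Function.Injective i) [hr : i.range.FiniteIndex] : ProClosed (i '' S) := by
  apply proClosed_of_finiteIndex
  intro g hg
  by_cases hgr : g ∈ i.range
  · obtain ⟨x, rfl⟩ := hgr
    obtain ⟨N, _, hN, h⟩ := hS x fun h => hg ⟨x, h, rfl⟩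
    refine ⟨N.map i, ⟨?_⟩, ?_⟩
    · rw [Subgroup.index_map_of_injective _ hi]
      exact mul_ne_zero hN.index_ne_zero hr.index_ne_zero
    · rintro _ ⟨s, hs, rfl⟩ ⟨y, hy, hyx⟩
      rw [← map_inv, ← map_mul] at hyx
      exact h s hs (hi hyx ▸ hy)
  · refine ⟨i.range, hr, ?_⟩
    rintro _ ⟨s, _, rfl⟩ hm
    exact hgr ((i.range.mul_mem_cancel_left (i.range.inv_mem ⟨s, rfl⟩)).1 hm)

/-- `⟨f⟩` is the union of the finitely many translates `f^j ⟨f^n⟩`, `0 ≤ j < n`. -/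
theorem proClosed_zpowers_of_pow {f : Γ} {n : ℕ} (hn : n ≠ 0)
    (h : ProClosed (Subgroup.zpowers (f ^ n) : Set Γ)) :
    ProClosed (Subgroup.zpowers f : Set Γ) := by
  have : (Subgroup.zpowers f : Set Γ) =
      ⋃ j ∈ Finset.range n, (fun y => f ^ j * y) '' (Subgroup.zpowers (f ^ n) : Set Γ) := by
    ext x
    simp only [SetLike.mem_coe, Set.mem_iUnion, Set.mem_image, Subgroup.mem_zpowers_iff,
      Finset.mem_range]
    constructor
    · rintro ⟨k, rfl⟩
      have hn' : (n : ℤ) ≠ 0 := by exact_mod_cast hn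
      have h0 := Int.emod_nonneg k hn'
      have h1 := Int.emod_lt_of_pos k (by positivity : (0 : ℤ) < n)
      refine ⟨(k % n).toNat, by omega, _, ⟨k / n, rfl⟩, ?_⟩
      rw [← zpow_natCast f n, ← zpow_mul, ← zpow_natCast, ← zpow_add, Int.toNat_of_nonneg h0,
        Int.emod_add_mul_ediv]
    · rintro ⟨j, _, _, ⟨k, rfl⟩, rfl⟩
      exact ⟨j + n * k, by rw [zpow_add, zpow_natCast, zpow_mul, zpow_natCast]⟩
  rw [this]
  exact ProClosed.biUnion _ fun j _ => h.mul_left _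

theorem proClosed_zpowers_of_finiteIndex (i : Γ →* Δ) (hi : Function.Injective i)
    [i.range.FiniteIndex] (h : ∀ x : Γ, ProClosed (Subgroup.zpowers x : Set Γ)) (f : Δ) :
    ProClosed (Subgroup.zpowers f : Set Δ) := by
  obtain ⟨n, hn, -, x, hx⟩ := i.range.exists_pow_mem_of_index_ne_zero
    Subgroup.FiniteIndex.index_ne_zero f
  refine proClosed_zpowers_of_pow hn.ne' ?_
  have := (h x).image i hi
  rwa [← Subgroup.coe_map, MonoidHom.map_zpowers, hx] at this

theorem ProClosed.zpowers_conj {f : Γ} (h : ProClosed (Subgroup.zpowers f : Set Γ)) (x : Γ) :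
    ProClosed (Subgroup.zpowers (x * f * x⁻¹) : Set Γ) := by
  have := h.preimage (MulAut.conj x⁻¹).toMonoidHom
  convert this using 1
  ext y
  simp only [SetLike.mem_coe, Set.mem_preimage, Subgroup.mem_zpowers_iff, conj_zpow]
  refine exists_congr fun k => ?_
  constructor
  · rintro rfl
    simp [mul_assoc]
  · intro h
    rw [h]
    simp [mul_assoc]

theorem exists_normal_finiteIndex_disjoint (h : ProClosed ({1} : Set Γ)) (T : Finset Γ)
    (hT : 1 ∉ T) : ∃ N : Subgroup Γ, N.Normal ∧ N.FiniteIndex ∧ ∀ x ∈ T, x ∉ N := by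
  classical
  induction T using Finset.induction_on with
  | empty => exact ⟨⊤, inferInstance, inferInstance, by simp⟩
  | insert x T _ ih =>
    rw [Finset.mem_insert, not_or] at hT
    obtain ⟨N, _, _, hN⟩ := ih hT.2
    obtain ⟨N', _, _, hN'⟩ := h x fun hx => hT.1 hx.symm
    refine ⟨N ⊓ N', inferInstance, inferInstance, ?_⟩
    intro y hy hm
    rcases Finset.mem_insert.1 hy with rfl | hy
    · exact hN' 1 rfl (by simpa using hm.2)
    · exact hN y hy hm.1

theorem ProClosed.finitelySeparable {Γ : Type*} [Group Γ] {F : Subgroup Γ}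
    (h : ProClosed (F : Set Γ)) : FinitelySeparable F := by
  intro g hg
  obtain ⟨N, _, _, hN⟩ := h g hg
  refine ⟨Γ ⧸ N, inferInstance, inferInstance, QuotientGroup.mk' N,
    QuotientGroup.mk'_surjective N, ?_⟩
  rintro ⟨s, hs, hsg⟩
  exact hN s hs (QuotientGroup.eq.1 hsg)

end ProClosed

/-! ### Cyclic subgroups of free and virtually free groups. -/

section FreeGroup

variable {ι : Type*}

/-- The action of a free group on a set, truncated to a finite subset `S`. -/
theorem exists_truncated_action {X : Type*} [MulAction (FreeGroup ι) X] (S : Set X) [Finite S] :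
    ∃ ρ : FreeGroup ι →* Equiv.Perm S, ∀ (L : List (ι × Bool)) (p : S),
      (∀ L', L' <:+ L → FreeGroup.mk L' • (p : X) ∈ S) →
      (ρ (FreeGroup.mk L) p : X) = FreeGroup.mk L • (p : X) := by
  classical
  have := Fintype.ofFinite S
  have key : ∀ i : ι, ∃ e : Equiv.Perm S, ∀ s : S, FreeGroup.of i • (s : X) ∈ S →
      (e s : X) = FreeGroup.of i • (s : X) := by
    intro i
    -- A generator acts as a partial injection of `S`; a bijection between two subsets of a finite
    -- set extends to a permutation of it.
    let e : {s : S // FreeGroup.of i • (s : X) ∈ S} ≃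
        {s : S // (FreeGroup.of i)⁻¹ • (s : X) ∈ S} :=
      { toFun := fun s => ⟨⟨_, s.2⟩, by simp⟩
        invFun := fun s => ⟨⟨_, s.2⟩, by simp⟩
        left_inv := fun s => by simp
        right_inv := fun s => by simp }
    refine ⟨e.extendSubtype, fun s hs => ?_⟩
    rw [e.extendSubtype_apply_of_mem s hs]
    rfl
  choose e he using key
  refine ⟨FreeGroup.lift e, fun L p => ?_⟩
  induction L with
  | nil => intro _; simp [← FreeGroup.one_eq_mk]
  | cons x L ih =>
    intro hL
    have ih := ih fun L' h => hL L' (h.trans (List.suffix_cons x L))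
    have h1 := hL _ List.suffix_rfl
    have h2 := hL L (List.suffix_cons x L)
    have hx : FreeGroup.mk (x :: L) = FreeGroup.mk [x] * FreeGroup.mk L := by
      rw [FreeGroup.mul_mk]; rfl
    rw [hx, mul_smul] at h1
    rw [hx, mul_smul, map_mul, Equiv.Perm.mul_apply, ← ih]
    rw [← ih] at h1
    generalize (FreeGroup.lift e) (FreeGroup.mk L) p = q at *
    obtain ⟨i, _ | _⟩ := x
    · have hi : (FreeGroup.mk [(i, false)] : FreeGroup ι) = (FreeGroup.of i)⁻¹ := rfl
      rw [hi] at h1 ⊢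
      rw [map_inv, FreeGroup.lift_apply_of]
      have : e i ⟨_, h1⟩ = q := Subtype.ext (by rw [he i _ (by simp)]; simp)
      rw [← this, Equiv.Perm.inv_def, Equiv.symm_apply_apply, this]
    · exact (congrArg Subtype.val (by rw [← FreeGroup.of, FreeGroup.lift_apply_of])).trans
        (he i q h1)

/-- The action on the cosets of `⟨f⟩` is truncated to the points visited when the words of `f` and
`g` are read from the base coset. The truncated action still has `f` fixing the base point and `g`
moving it, so the stabiliser of that point pulls back to a subgroup of finite index that contains
`f` and not `g`. -/
theorem proClosed_zpowers_freeGroup (f : FreeGroup ι) :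
    ProClosed (Subgroup.zpowers f : Set (FreeGroup ι)) := by
  classical
  apply proClosed_of_finiteIndex
  intro g hg
  let X := FreeGroup ι ⧸ Subgroup.zpowers f
  let p : X := ((1 : FreeGroup ι) : X)
  let U : FreeGroup ι → Set X := fun h => {x | ∃ L, L <:+ h.toWord ∧ x = FreeGroup.mk L • p}
  have hU : ∀ h, (U h).Finite := by
    intro h
    have : U h = (fun L => FreeGroup.mk L • p) '' {L | L ∈ h.toWord.tails} := by
      ext x; simp [U, eq_comm]
    rw [this]
    exact (List.finite_toSet _).image _
  have hS : (U f ∪ U g).Finite := (hU f).union (hU g)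
  have := hS.to_subtype
  obtain ⟨ρ, hρ⟩ := exists_truncated_action (ι := ι) (U f ∪ U g)
  let q : ↥(U f ∪ U g) := ⟨p, Or.inl ⟨[], List.nil_suffix, by simp [← FreeGroup.one_eq_mk]⟩⟩
  have hf : ρ f q = q := by
    apply Subtype.ext
    have := hρ f.toWord q fun L' h => Or.inl ⟨L', h, rfl⟩
    rw [FreeGroup.mk_toWord] at this
    rw [this]
    change ((f * 1 : FreeGroup ι) : X) = ((1 : FreeGroup ι) : X)
    rw [QuotientGroup.eq]
    simp
  have hgq : ρ g q ≠ q := by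
    intro h
    have h1 := hρ g.toWord q fun L' h => Or.inr ⟨L', h, rfl⟩
    rw [FreeGroup.mk_toWord, h] at h1
    have h2 : ((1 : FreeGroup ι) : X) = ((g * 1 : FreeGroup ι) : X) := h1
    rw [QuotientGroup.eq] at h2
    exact hg (by simpa using h2)
  refine ⟨(MulAction.stabilizer (Equiv.Perm ↥(U f ∪ U g)) q).comap ρ, finiteIndex_comap _ _, ?_⟩
  rintro _ ⟨k, rfl⟩ hm
  apply hgq
  have hk : f ^ k ∈ (MulAction.stabilizer (Equiv.Perm ↥(U f ∪ U g)) q).comap ρ :=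
    Subgroup.zpow_mem _ (Subgroup.mem_comap.2 (MulAction.mem_stabilizer_iff.2 hf)) k
  have := Subgroup.mul_mem _ hk hm
  rw [mul_inv_cancel_left] at this
  exact MulAction.mem_stabilizer_iff.1 this

theorem proClosed_zpowers_semidirectProduct {N Q : Type*} [Group N] [Group Q] [Finite Q]
    {σ : Q →* MulAut N} (hN : ∀ x : N, ProClosed (Subgroup.zpowers x : Set N)) (f : N ⋊[σ] Q) :
    ProClosed (Subgroup.zpowers f : Set (N ⋊[σ] Q)) := by
  have : (SemidirectProduct.inl : N →* N ⋊[σ] Q).range.FiniteIndex := by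
    rw [SemidirectProduct.range_inl_eq_ker_rightHom]
    infer_instance
  exact proClosed_zpowers_of_finiteIndex SemidirectProduct.inl SemidirectProduct.inl_injective hN f

end FreeGroup
theorem proClosed_zpowers_multiplicative_int (f : Multiplicative ℤ) :
    ProClosed (Subgroup.zpowers f : Set (Multiplicative ℤ)) := by
  have h := (proClosed_zpowers_freeGroup (FreeGroup.mulEquivIntOfUnique.symm f)).preimage
    (FreeGroup.mulEquivIntOfUnique (α := Unit)).symm.toMonoidHom
  convert h using 1
  ext x
  simp only [SetLike.mem_coe, Set.mem_preimage, Subgroup.mem_zpowers_iff]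
  exact exists_congr fun k => by
    rw [← map_zpow]
    exact (FreeGroup.mulEquivIntOfUnique (α := Unit)).symm.injective.eq_iff.symm

/-! ### The Baumslag–Solitar group: normal form, residual finiteness, closed cyclic subgroups. -/

/-- The relator of the Baumslag–Solitar group `⟨a, t; t⁻¹ a t = a²⟩`. -/
def bsRelators : Set (FreeGroup (Fin 2)) :=
  {((FreeGroup.of 1)⁻¹ * FreeGroup.of 0 * FreeGroup.of 1) * (FreeGroup.of 0 ^ 2)⁻¹}

/-- The Baumslag–Solitar group `⟨a, t; t⁻¹ a t = a²⟩`. -/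
abbrev BS : Type := PresentedGroup bsRelators

namespace BS

open scoped commutatorElement

/-- The first generator. -/
def a : BS := PresentedGroup.of 0

/-- The second generator. -/
def t : BS := PresentedGroup.of 1

theorem rel : t⁻¹ * a * t = a ^ 2 := by
  have h := PresentedGroup.one_of_mem (rels := bsRelators) (Set.mem_singleton _)
  rw [map_mul, map_inv, mul_inv_eq_one] at h
  exact h.trans (map_pow _ _ _)

/-- The homomorphism of `BS` determined by images of the generators. -/
def lift {Γ : Type*} [Group Γ] (x y : Γ) (h : y⁻¹ * x * y = x ^ 2) : BS →* Γ :=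
  PresentedGroup.toGroup (f := ![x, y]) (by
    rintro r rfl
    simp [h])

section lift
variable {Γ : Type*} [Group Γ] (x y : Γ) (h : y⁻¹ * x * y = x ^ 2)

@[simp] theorem lift_a : lift x y h a = x := by
  rw [lift, a, PresentedGroup.toGroup.of]; rfl

@[simp] theorem lift_t : lift x y h t = y := by
  rw [lift, t, PresentedGroup.toGroup.of]; rfl

theorem hom_ext {f g : BS →* Γ} (ha : f a = g a) (ht : f t = g t) : f = g := by
  apply PresentedGroup.ext
  intro i
  fin_cases i
  · exact ha
  · exact ht

end lift

theorem a_zpow_mul_t_pow (k : ℤ) (j : ℕ) : a ^ k * t ^ j = t ^ j * a ^ (2 ^ j * k) := by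
  have h1 : ∀ m : ℤ, a ^ m * t = t * a ^ (2 * m) := by
    intro m
    have := conj_zpow (a := t⁻¹) (b := a) (i := m)
    rw [inv_inv, rel, ← zpow_natCast, ← zpow_mul, mul_assoc, eq_inv_mul_iff_mul_eq] at this
    exact this.symm
  induction j generalizing k with
  | zero => simp
  | succ j ih =>
    rw [pow_succ', ← mul_assoc, h1, mul_assoc, ih, ← mul_assoc]
    congr 2
    ring

theorem inv_t_pow_mul_a_zpow (k : ℤ) (j : ℕ) :
    (t ^ j)⁻¹ * a ^ k = a ^ (2 ^ j * k) * (t ^ j)⁻¹ := by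
  rw [eq_mul_inv_iff_mul_eq, mul_assoc, a_zpow_mul_t_pow, inv_mul_cancel_left]

/-- Elements of this form stay so under right multiplication by generators and their inverses,
because moving `a` past `t` only doubles its exponent. -/
theorem exists_eq (β : BS) : ∃ (i : ℕ) (k : ℤ) (j : ℕ), β = t ^ i * a ^ k * (t ^ j)⁻¹ := by
  have hβ : β ∈ Subgroup.closure (Set.range (PresentedGroup.of : Fin 2 → BS)) := by
    rw [PresentedGroup.closure_range_of]
    trivial
  have ha : ∀ (e : ℤ) (x : BS), (∃ (i : ℕ) (k : ℤ) (j : ℕ), x = t ^ i * a ^ k * (t ^ j)⁻¹) →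
      ∃ (i : ℕ) (k : ℤ) (j : ℕ), x * a ^ e = t ^ i * a ^ k * (t ^ j)⁻¹ := by
    rintro e _ ⟨i, k, j, rfl⟩
    refine ⟨i, k + 2 ^ j * e, j, ?_⟩
    rw [mul_assoc, inv_t_pow_mul_a_zpow, zpow_add]
    simp only [mul_assoc]
  induction hβ using Subgroup.closure_induction_right with
  | one => exact ⟨0, 0, 0, by simp⟩
  | mul_right x _ y hy ih =>
    obtain ⟨n, rfl⟩ := hy
    fin_cases n
    · simpa [a] using ha 1 x ih
    · obtain ⟨i, k, j, rfl⟩ := ih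
      change ∃ (i' : ℕ) (k' : ℤ) (j' : ℕ), t ^ i * a ^ k * (t ^ j)⁻¹ * t = _
      cases j with
      | zero =>
        refine ⟨i + 1, 2 * k, 0, ?_⟩
        have := a_zpow_mul_t_pow k 1
        rw [pow_one, pow_one] at this
        rw [pow_zero, inv_one, mul_one, mul_one, mul_assoc, this, pow_succ, mul_assoc]
      | succ j => exact ⟨i, k, j, by rw [pow_succ' t j]; group⟩
  | mul_inv_cancel x _ y hy ih =>
    obtain ⟨n, rfl⟩ := hy
    fin_cases n
    · simpa [a] using ha (-1) x ih
    · obtain ⟨i, k, j, rfl⟩ := ih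
      change ∃ (i' : ℕ) (k' : ℤ) (j' : ℕ), t ^ i * a ^ k * (t ^ j)⁻¹ * t⁻¹ = _
      exact ⟨i, k, j + 1, by rw [pow_succ' t j, mul_inv_rev]; simp only [mul_assoc]⟩

/-- The exponent sum of `t`. -/
def tExp : BS →* Multiplicative ℤ :=
  lift 1 (Multiplicative.ofAdd 1) (by simp)

@[simp] theorem tExp_a : tExp a = 1 := lift_a _ _ _

@[simp] theorem tExp_t : tExp t = Multiplicative.ofAdd 1 := lift_t _ _ _

theorem tExp_eq (i : ℕ) (k : ℤ) (j : ℕ) :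
    tExp (t ^ i * a ^ k * (t ^ j)⁻¹) = Multiplicative.ofAdd ((i : ℤ) - j) := by
  simp [← ofAdd_nsmul, ← ofAdd_neg, ← ofAdd_add, sub_eq_add_neg]

theorem exists_eq_of_tExp_eq_one {β : BS} (h : tExp β = 1) :
    ∃ (i : ℕ) (k : ℤ), β = t ^ i * a ^ k * (t ^ i)⁻¹ := by
  obtain ⟨i, k, j, rfl⟩ := exists_eq β
  rw [tExp_eq, ofAdd_eq_one, sub_eq_zero] at h
  obtain rfl : i = j := by exact_mod_cast h
  exact ⟨i, k, rfl⟩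

/-- The action of `BS` on `ℤ / n`, for odd `n`: `a` adds one and `t` halves. -/
def toPerm (n : ℕ) (hn : Nat.Coprime 2 n) : BS →* Equiv.Perm (ZMod n) :=
  lift (Equiv.addRight 1) ((ZMod.unitOfCoprime 2 hn)⁻¹).mulLeft (by
    rw [mul_assoc, inv_mul_eq_iff_eq_mul]
    ext x : 1
    have h2 : ((ZMod.unitOfCoprime 2 hn)⁻¹ : (ZMod n)ˣ) * (2 : ZMod n) = 1 := by
      have := (ZMod.unitOfCoprime 2 hn).inv_mul
      rwa [ZMod.coe_unitOfCoprime] at this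
    simp only [Equiv.Perm.mul_apply, pow_two, Equiv.coe_addRight, Units.mulLeft_apply]
    linear_combination -h2)

theorem toPerm_a_zpow (n : ℕ) (hn : Nat.Coprime 2 n) (k : ℤ) :
    toPerm n hn (a ^ k) = Equiv.addRight (k : ZMod n) := by
  rw [map_zpow, toPerm, lift_a]
  simp

theorem toPerm_a_zpow_eq_one_iff (n : ℕ) (hn : Nat.Coprime 2 n) (k : ℤ) :
    toPerm n hn (a ^ k) = 1 ↔ (n : ℤ) ∣ k := by
  rw [toPerm_a_zpow, ← ZMod.intCast_zmod_eq_zero_iff_dvd]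
  constructor
  · intro h
    simpa using Equiv.congr_fun h 0
  · intro h
    ext x
    simp [h]

theorem exists_perm_a_zpow_ne_one {k : ℤ} (hk : k ≠ 0) :
    ∃ (n : ℕ) (hn : Nat.Coprime 2 n), n ≠ 0 ∧ toPerm n hn (a ^ k) ≠ 1 := by
  -- An odd modulus exceeding `|k|`, which therefore cannot divide `k ≠ 0`.
  have hn : Nat.Coprime 2 (2 * k.natAbs + 1) := by simp
  refine ⟨_, hn, by omega, ?_⟩
  rw [ne_eq, toPerm_a_zpow_eq_one_iff, Int.natCast_dvd]
  intro h
  have := Nat.le_of_dvd (by omega) h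
  omega

theorem a_zpow_eq_one_iff {k : ℤ} : a ^ k = 1 ↔ k = 0 := by
  constructor
  · intro h
    by_contra hk
    obtain ⟨n, hn, -, h'⟩ := exists_perm_a_zpow_ne_one hk
    exact h' (by rw [h, map_one])
  · rintro rfl
    simp

theorem a_zpow_injective : Function.Injective fun k : ℤ => a ^ k := by
  intro k l h
  have : a ^ (k - l) = 1 := by rw [zpow_sub]; exact mul_inv_eq_one.2 h
  exact sub_eq_zero.1 (a_zpow_eq_one_iff.1 this)

/-- Elements with nonzero exponent sum of `t` survive in `ℤ`; the others are conjugates of powers of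
`a` and survive in some action on `ZMod n`. -/
theorem proClosed_one : ProClosed ({1} : Set BS) := by
  intro g hg
  by_cases h : tExp g = 1
  · obtain ⟨i, k, rfl⟩ := exists_eq_of_tExp_eq_one h
    have hk : k ≠ 0 := by
      rintro rfl
      simp at hg
    obtain ⟨n, hn, h0, h1⟩ := exists_perm_a_zpow_ne_one hk
    have : NeZero n := ⟨h0⟩
    refine ⟨(toPerm n hn).ker, inferInstance, inferInstance, ?_⟩
    rintro _ rfl hm
    apply h1
    simpa [MonoidHom.mem_ker] using hm
  · obtain ⟨N, h1, h2, h3⟩ := (proClosed_zpowers_multiplicative_int 1).preimage tExp g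
      (by simpa [Subgroup.mem_bot] using h)
    exact ⟨N, h1, h2, fun s hs => h3 s (by rw [Set.mem_singleton_iff.1 hs]; simp)⟩

/-- After conjugation `z = a^m`, `m ≠ 0`, and `β = t^p a^q t^(-s)`. Commuting then gives `2^s m =
2^p m`, so `s = p`. -/
theorem tExp_eq_one_of_commute {β z : BS} (hz : tExp z = 1) (h1 : z ≠ 1) (h : Commute β z) :
    tExp β = 1 := by
  obtain ⟨i, m, rfl⟩ := exists_eq_of_tExp_eq_one hz
  have hm : m ≠ 0 := by
    rintro rfl
    simp at h1
  obtain ⟨p, q, s, hβ⟩ := exists_eq ((t ^ i)⁻¹ * β * t ^ i)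
  have h2 : (t ^ i)⁻¹ * β * t ^ i * a ^ m = a ^ m * ((t ^ i)⁻¹ * β * t ^ i) := by
    have := h.eq
    calc _ = (t ^ i)⁻¹ * (β * (t ^ i * a ^ m * (t ^ i)⁻¹)) * t ^ i := by group
      _ = _ := by rw [this]; group
  have h3 : tExp ((t ^ i)⁻¹ * β * t ^ i) = tExp β := by
    simp [mul_comm]
  rw [hβ] at h2 h3
  rw [mul_assoc, inv_t_pow_mul_a_zpow, ← mul_assoc, mul_assoc (t ^ p), ← zpow_add,
    ← mul_assoc, ← mul_assoc, a_zpow_mul_t_pow, mul_assoc (t ^ p) _ (a ^ q), ← zpow_add,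
    mul_left_inj, mul_right_inj] at h2
  have h4 := a_zpow_injective h2
  have h5 : (2 : ℤ) ^ s = 2 ^ p := mul_right_cancel₀ hm (by linarith)
  have h6 : s = p := Int.pow_right_injective (by norm_num) h5
  rw [← h3, tExp_eq, h6]
  simp

/-- If `γ = β^j z` with `tExp z = 1` and `z ≠ 1`, then `z` does not commute with `β`. In a finite
quotient where the commutator survives, `γ` is no power of `β`, since otherwise `z` would be one too
and would commute with `β`. -/
theorem proClosed_zpowers {β : BS} (hβ : β = 1 ∨ tExp β ≠ 1) :
    ProClosed (Subgroup.zpowers β : Set BS) := by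
  rcases hβ with rfl | hβ
  · simpa using proClosed_one
  intro γ hγ
  by_cases h : tExp γ ∈ Subgroup.zpowers (tExp β)
  · obtain ⟨j, hj⟩ := h
    have hz : tExp (β ^ (-j) * γ) = 1 := by
      rw [map_mul, map_zpow, ← hj]
      simp
    have hz1 : β ^ (-j) * γ ≠ 1 := by
      intro h1
      apply hγ
      rw [zpow_neg, inv_mul_eq_one] at h1
      exact ⟨j, h1⟩
    have hc : ¬ Commute β (β ^ (-j) * γ) := fun hc => hβ (tExp_eq_one_of_commute hz hz1 hc)
    obtain ⟨N, _, h2, h3⟩ := proClosed_one ⁅β, β ^ (-j) * γ⁆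
      (by simpa [commutatorElement_eq_one_iff_commute] using hc)
    refine ⟨N, inferInstance, h2, ?_⟩
    rintro _ ⟨k, rfl⟩ hm
    apply h3 1 rfl
    rw [inv_one, one_mul, ← QuotientGroup.eq_one_iff]
    have hq : ((β : BS ⧸ N)) ^ k = γ := by
      have := QuotientGroup.eq.2 hm
      exact this
    change ⁅(β : BS ⧸ N), (β : BS ⧸ N) ^ (-j) * (γ : BS ⧸ N)⁆ = 1
    rw [commutatorElement_eq_one_iff_commute, ← hq, ← zpow_add]
    exact Commute.self_zpow _ _
  · obtain ⟨N, h1, h2, h3⟩ :=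
      (proClosed_zpowers_multiplicative_int (tExp β)).preimage tExp γ h
    refine ⟨N, h1, h2, ?_⟩
    rintro _ ⟨k, rfl⟩
    exact h3 _ ⟨k, by simp⟩

end BS
-- Reduced words under maps of the letters.
section Words

variable {P Q : Type*}

/-- The word obtained by applying `f` to the letters of a word. -/
def mapWord (f : P → Q) (L : List (P × Bool)) : List (Q × Bool) := L.map (Prod.map f id)

@[simp] theorem mapWord_nil (f : P → Q) : mapWord f [] = [] := rfl

@[simp] theorem mapWord_cons (f : P → Q) (x : P × Bool) (L : List (P × Bool)) :
    mapWord f (x :: L) = (f x.1, x.2) :: mapWord f L := rfl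

@[simp] theorem mapWord_append (f : P → Q) (L₁ L₂ : List (P × Bool)) :
    mapWord f (L₁ ++ L₂) = mapWord f L₁ ++ mapWord f L₂ := List.map_append

@[simp] theorem length_mapWord (f : P → Q) (L : List (P × Bool)) :
    (mapWord f L).length = L.length := List.length_map _

theorem head?_mapWord (f : P → Q) (L : List (P × Bool)) :
    (mapWord f L).head? = L.head?.map (Prod.map f id) := List.head?_map

theorem map_mk_eq (f : P → Q) (L : List (P × Bool)) :
    FreeGroup.map f (FreeGroup.mk L) = FreeGroup.mk (mapWord f L) := by
  rw [FreeGroup.map.mk]; rfl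

theorem isReduced_mapWord {f : P → Q} {L : List (P × Bool)}
    (hf : ∀ x ∈ L, ∀ y ∈ L, f x.1 = f y.1 → x.1 = y.1) (hL : FreeGroup.IsReduced L) :
    FreeGroup.IsReduced (mapWord f L) := by
  induction L with
  | nil => exact FreeGroup.IsReduced.nil
  | cons x L ih =>
    have hL' : FreeGroup.IsReduced L := hL.infix ⟨[x], [], by simp⟩
    have ih := ih (fun y hy z hz => hf y (.tail _ hy) z (.tail _ hz)) hL'
    cases L with
    | nil => exact FreeGroup.IsReduced.singleton
    | cons y L =>
      rw [mapWord_cons, mapWord_cons, FreeGroup.isReduced_cons_cons]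
      refine ⟨fun h => ?_, ih⟩
      exact (FreeGroup.isReduced_cons_cons.1 hL).1 (hf x (by simp) y (by simp) h)

theorem isReduced_append_of_head?_eq {L L₁ L₂ : List (P × Bool)}
    (h : FreeGroup.IsReduced (L ++ L₁)) (h₂ : FreeGroup.IsReduced L₂)
    (h₁₂ : L₂.head? = L₁.head?) : FreeGroup.IsReduced (L ++ L₂) := by
  unfold FreeGroup.IsReduced at *
  rw [List.isChain_append] at *
  exact ⟨h.1, h₂, fun x hx y hy => h.2.2 x hx y (h₁₂ ▸ hy)⟩

theorem norm_mk_of_isReduced [DecidableEq P] {L : List (P × Bool)}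
    (h : FreeGroup.IsReduced L) : (FreeGroup.mk L).norm = L.length := by
  rw [FreeGroup.norm, FreeGroup.toWord_mk, h.reduce_eq]

theorem norm_map_le [DecidableEq P] [DecidableEq Q] (f : P → Q) (x : FreeGroup P) :
    (FreeGroup.map f x).norm ≤ x.norm := by
  conv_lhs => rw [← FreeGroup.mk_toWord (x := x), map_mk_eq]
  exact FreeGroup.norm_mk_le.trans (length_mapWord _ _).le

theorem mk_ne_one_of_isReduced {L : List (P × Bool)} (h : FreeGroup.IsReduced L)
    (hL : L ≠ []) : FreeGroup.mk L ≠ 1 := by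
  classical
  intro h1
  rw [← FreeGroup.norm_eq_zero, norm_mk_of_isReduced h] at h1
  exact hL (List.length_eq_zero_iff.1 h1)

end Words

/-! ### The free product of `P` and an infinite cyclic group, and its straight elements. -/

section FreeWreath

variable {P Q : Type*} [Group P] [Group Q]

/-- The action of `P` on the free group on `P` by left translation of the free generators. -/
def shift (P : Type*) [Group P] : P →* MulAut (FreeGroup P) where
  toFun p := FreeGroup.freeGroupCongr (Equiv.mulLeft p)
  map_one' := by
    apply MulEquiv.toMonoidHom_injective
    ext
    simp
  map_mul' p q := by
    apply MulEquiv.toMonoidHom_injective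
    ext
    simp [mul_assoc]

theorem shift_apply (p : P) (x : FreeGroup P) :
    shift P p x = FreeGroup.map (fun y => p * y) x := rfl

/-- The semidirect product of the free group on `P` and `P`, which is the free product of `P` and
an infinite cyclic group. -/
abbrev FreeWreath (P : Type*) [Group P] : Type _ := FreeGroup P ⋊[shift P] P

namespace FreeWreath

open SemidirectProduct

/-- The map of semidirect products induced by a homomorphism. -/
def mapHom (q : P →* Q) : FreeWreath P →* FreeWreath Q :=
  SemidirectProduct.map (FreeGroup.map q) q (by
    intro p
    ext
    simp [shift_apply])

theorem norm_shift [DecidableEq P] (p : P) (x : FreeGroup P) : (shift P p x).norm = x.norm := by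
  apply le_antisymm (norm_map_le _ _)
  have h : x = shift P p⁻¹ (shift P p x) := by
    rw [← MulAut.mul_apply, ← map_mul]
    simp
  conv_lhs => rw [h]
  exact norm_map_le _ _

/-- No cancellation occurs in the powers of `f`, where `L` is a word for the left component. -/
structure Straight (f : FreeWreath P) (L : List (P × Bool)) : Prop where
  left_eq : f.left = FreeGroup.mk L
  ne_nil : L ≠ []
  isReduced : FreeGroup.IsReduced (L ++ mapWord (fun y => f.right * y) L)

/-- The word of `f^(n+1)` is `L` followed by the translate by `f.right` of the word of `f^n`.
Whether the junction is reduced depends only on the first letter after it, which is the same as in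
the hypothesis on `L`; hence the clause on `head?`. -/
theorem Straight.pow {f : FreeWreath P} {L : List (P × Bool)} (h : Straight f L) (n : ℕ) :
    ∃ V : List (P × Bool), (f ^ n).left = FreeGroup.mk V ∧ FreeGroup.IsReduced V ∧
      V.length = n * L.length ∧ (n ≠ 0 → V.head? = L.head?) := by
  induction n with
  | zero => exact ⟨[], rfl, FreeGroup.IsReduced.nil, by simp, by simp⟩
  | succ n ih =>
    obtain ⟨V, h1, h2, h3, h4⟩ := ih
    refine ⟨L ++ mapWord (fun y => f.right * y) V, ?_, ?_, ?_, ?_⟩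
    · rw [pow_succ', mul_left, h1, h.left_eq, shift_apply, map_mk_eq, FreeGroup.mul_mk]
    · by_cases hn : n = 0
      · subst hn
        rw [zero_mul, List.length_eq_zero_iff] at h3
        subst h3
        simpa using h.isReduced.infix (L₁ := L) ⟨[], _, by simp; rfl⟩
      · refine isReduced_append_of_head?_eq h.isReduced
          (isReduced_mapWord (fun x _ y _ h => mul_left_cancel h) h2) ?_
        rw [head?_mapWord, head?_mapWord, h4 hn]
    · rw [List.length_append, length_mapWord, h3]
      ring
    · intro _
      rw [List.head?_append_of_ne_nil _ h.ne_nil]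

theorem Straight.norm_zpow [DecidableEq P] {f : FreeWreath P} {L : List (P × Bool)}
    (h : Straight f L) (j : ℤ) : (f ^ j).left.norm = j.natAbs * L.length := by
  have hpow : ∀ n : ℕ, (f ^ n).left.norm = n * L.length := by
    intro n
    obtain ⟨V, h1, h2, h3, -⟩ := h.pow n
    rw [h1, norm_mk_of_isReduced h2, h3]
  obtain ⟨n, rfl | rfl⟩ := j.eq_nat_or_neg
  · rw [zpow_natCast, hpow, Int.natAbs_natCast]
  · rw [zpow_neg, zpow_natCast, inv_left, norm_shift, FreeGroup.norm_inv_eq, hpow, Int.natAbs_neg,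
      Int.natAbs_natCast]

theorem Straight.mapHom {f : FreeWreath P} {L : List (P × Bool)} (h : Straight f L) (q : P →* Q)
    (hq : ∀ x ∈ L ++ mapWord (fun y => f.right * y) L,
      ∀ y ∈ L ++ mapWord (fun y => f.right * y) L, q x.1 = q y.1 → x.1 = y.1) :
    Straight (mapHom q f) (mapWord q L) := by
  refine ⟨?_, ?_, ?_⟩
  · rw [FreeWreath.mapHom, map_left, h.left_eq, map_mk_eq]
  · simpa [mapWord] using h.ne_nil
  · have := isReduced_mapWord hq h.isReduced
    rw [mapWord_append] at this
    convert this using 2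
    simp [mapWord, FreeWreath.mapHom]

/-- `T` consists of the nontrivial quotients `x⁻¹ y` of letters of `L`: avoiding it keeps distinct
letters distinct modulo `N`, so reduced words stay reduced. -/
theorem exists_finset_injOn (L : List (P × Bool)) :
    ∃ T : Finset P, 1 ∉ T ∧ ∀ (N : Subgroup P) [N.Normal], (∀ x ∈ T, x ∉ N) →
      ∀ x ∈ L, ∀ y ∈ L, QuotientGroup.mk' N x.1 = QuotientGroup.mk' N y.1 → x.1 = y.1 := by
  classical
  refine ⟨((L.toFinset ×ˢ L.toFinset).image fun z => z.1.1⁻¹ * z.2.1).erase 1,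
    Finset.notMem_erase _ _, ?_⟩
  intro N _ hN x hx y hy hxy
  by_contra hne
  refine hN (x.1⁻¹ * y.1) (Finset.mem_erase.2 ⟨?_, ?_⟩) (QuotientGroup.eq.1 hxy)
  · rwa [ne_eq, inv_mul_eq_one]
  · exact Finset.mem_image.2 ⟨(x, y), by simp [hx, hy], rfl⟩

theorem exists_finset_mapHom_left_ne_one {x : FreeGroup P} (hx : x ≠ 1) :
    ∃ T : Finset P, 1 ∉ T ∧ ∀ (N : Subgroup P) [N.Normal], (∀ x ∈ T, x ∉ N) →
      FreeGroup.map (QuotientGroup.mk' N) x ≠ 1 := by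
  classical
  obtain ⟨T, h1, hT⟩ := exists_finset_injOn x.toWord
  refine ⟨T, h1, fun N _ hN => ?_⟩
  rw [← FreeGroup.mk_toWord (x := x), map_mk_eq]
  apply mk_ne_one_of_isReduced (isReduced_mapWord (hT N hN) FreeGroup.isReduced_toWord)
  simpa [mapWord] using hx

theorem exists_finset_mapHom_ne_one {g : FreeWreath P} (hg : g ≠ 1) :
    ∃ T : Finset P, 1 ∉ T ∧ ∀ (N : Subgroup P) [N.Normal], (∀ x ∈ T, x ∉ N) →
      mapHom (QuotientGroup.mk' N) g ≠ 1 := by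
  by_cases h : g.left = 1
  · have hr : g.right ≠ 1 := fun hr => hg (SemidirectProduct.ext h hr)
    refine ⟨{g.right}, by simpa using hr.symm, fun N _ hN h1 => ?_⟩
    refine hN _ (Finset.mem_singleton_self _) ((QuotientGroup.eq_one_iff _).1 ?_)
    exact congrArg SemidirectProduct.right h1
  · obtain ⟨T, h1, hT⟩ := exists_finset_mapHom_left_ne_one h
    exact ⟨T, h1, fun N _ hN h => hT N hN (congrArg SemidirectProduct.left h)⟩

/-- Over the finite group `P ⧸ N` the semidirect product is virtually free, so its cyclic subgroups
are closed. -/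
theorem exists_normal_of_mapHom_notMem {f g : FreeWreath P} {N : Subgroup P} [N.Normal]
    [N.FiniteIndex] (h : mapHom (QuotientGroup.mk' N) g ∉
      Subgroup.zpowers (mapHom (QuotientGroup.mk' N) f)) :
    ∃ M : Subgroup (FreeWreath P), M.Normal ∧ M.FiniteIndex ∧
      ∀ s ∈ (Subgroup.zpowers f : Set (FreeWreath P)), s⁻¹ * g ∉ M := by
  obtain ⟨M, h1, h2, h3⟩ := (proClosed_zpowers_semidirectProduct (σ := shift (P ⧸ N))
    proClosed_zpowers_freeGroup (mapHom (QuotientGroup.mk' N) f)).preimage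
      (mapHom (QuotientGroup.mk' N)) g h
  refine ⟨M, h1, h2, ?_⟩
  rintro _ ⟨k, rfl⟩
  exact h3 _ ⟨k, by simp⟩

/-- Choose `N` so that `f` stays straight modulo `N`. If the image of `g` were the `j`-th power of
that of `f`, linear growth of length would force `|j| ≤ g.left.norm`; these finitely many `j` are
excluded by asking in advance that each `g f^(-j)` survive modulo `N`. -/
theorem Straight.proClosed_zpowers (hP : ProClosed ({1} : Set P)) {f : FreeWreath P}
    {L : List (P × Bool)} (h : Straight f L) :
    ProClosed (Subgroup.zpowers f : Set (FreeWreath P)) := by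
  classical
  intro g hg
  have hj : ∀ j : ℤ, g * f ^ (-j) ≠ 1 := by
    intro j hj
    rw [zpow_neg, mul_inv_eq_one] at hj
    exact hg ⟨j, hj.symm⟩
  choose T hT1 hT using fun j => exists_finset_mapHom_ne_one (hj j)
  obtain ⟨T', hT'1, hT'⟩ := exists_finset_injOn (L ++ mapWord (fun y => f.right * y) L)
  obtain ⟨N, _, _, hN⟩ := exists_normal_finiteIndex_disjoint hP
    (T' ∪ (Finset.Icc (-(g.left.norm : ℤ)) g.left.norm).biUnion T)
    (by simp [hT1, hT'1])
  apply exists_normal_of_mapHom_notMem (N := N)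
  rintro ⟨j, hj' : _ ^ j = _⟩
  have hs := h.mapHom (QuotientGroup.mk' N)
    (hT' N fun x hx => hN x (Finset.mem_union_left _ hx))
  have h1 := hs.norm_zpow j
  rw [hj', length_mapWord] at h1
  have h2 : (FreeWreath.mapHom (QuotientGroup.mk' N) g).left.norm ≤ g.left.norm :=
    norm_map_le _ _
  have h3 : j.natAbs ≤ g.left.norm :=
    (Nat.le_mul_of_pos_right _ (List.length_pos_iff.2 h.ne_nil)).trans (h1 ▸ h2)
  refine hT j N (fun x hx => hN x (Finset.mem_union_right _ (Finset.mem_biUnion.2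
    ⟨j, Finset.mem_Icc.2 (by omega), hx⟩))) ?_
  rw [map_mul, map_zpow, zpow_neg, mul_inv_eq_one]
  exact hj'.symm

theorem exists_normal_of_left_ne_one (hP : ProClosed ({1} : Set P)) (β : P) {g : FreeWreath P}
    (hg : g.left ≠ 1) : ∃ M : Subgroup (FreeWreath P), M.Normal ∧ M.FiniteIndex ∧
      ∀ s ∈ (Subgroup.zpowers (inr β : FreeWreath P) : Set (FreeWreath P)), s⁻¹ * g ∉ M := by
  obtain ⟨T, h1, hT⟩ := exists_finset_mapHom_left_ne_one hg
  obtain ⟨N, _, _, hN⟩ := exists_normal_finiteIndex_disjoint hP T h1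
  apply exists_normal_of_mapHom_notMem (N := N)
  rintro ⟨j, hj : _ ^ j = _⟩
  apply hT N hN
  rw [mapHom, map_inr, ← map_zpow] at hj
  exact (congrArg SemidirectProduct.left hj).symm

theorem proClosed_zpowers_inr (hP : ProClosed ({1} : Set P)) {β : P}
    (hβ : ProClosed (Subgroup.zpowers β : Set P)) :
    ProClosed (Subgroup.zpowers (inr β : FreeWreath P) : Set (FreeWreath P)) := by
  intro g hg
  by_cases h : g.left = 1
  · obtain ⟨M, h1, h2, h3⟩ := hβ.preimage rightHom g (by
      rintro ⟨k, hk⟩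
      refine hg ⟨k, ?_⟩
      change inr β ^ k = g
      rw [← map_zpow]
      exact SemidirectProduct.ext h.symm hk)
    refine ⟨M, h1, h2, ?_⟩
    rintro _ ⟨k, rfl⟩
    exact h3 _ ⟨k, by change β ^ k = rightHom (inr β ^ k); rw [map_zpow, rightHom_inr]⟩
  · exact exists_normal_of_left_ne_one hP β h

/-- Every element is conjugate to an element of `P` or to one in whose powers no cancellation
occurs. -/
theorem exists_conj_straight (f : FreeWreath P) :
    ∃ x : FreeWreath P, (∃ β : P, x * f * x⁻¹ = inr β) ∨ ∃ L, Straight (x * f * x⁻¹) L := by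
  classical
  induction hn : f.left.norm using Nat.strong_induction_on generalizing f with
  | _ n ih =>
  by_cases h1 : f.left = 1
  · refine ⟨1, Or.inl ⟨f.right, ?_⟩⟩
    rw [one_mul, inv_one, mul_one]
    exact SemidirectProduct.ext h1 rfl
  by_cases h2 : FreeGroup.IsReduced (f.left.toWord ++ mapWord (fun y => f.right * y) f.left.toWord)
  · refine ⟨1, Or.inr ⟨f.left.toWord, ?_⟩⟩
    rw [one_mul, inv_one, mul_one]
    exact ⟨FreeGroup.mk_toWord.symm, by simpa using h1, h2⟩
  obtain ⟨y, L, hL⟩ := List.exists_cons_of_ne_nil (mt FreeGroup.toWord_eq_nil_iff.1 h1)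
  have hred : FreeGroup.IsReduced (y :: L) := hL ▸ FreeGroup.isReduced_toWord
  -- Both halves are reduced, so cancellation can occur only at the junction, between the last
  -- letter and the translated first letter.
  obtain ⟨z, hz, hzy⟩ : ∃ z ∈ (y :: L).getLast?, ¬ (z.1 = f.right * y.1 → z.2 = y.2) := by
    by_contra! hcon
    apply h2
    rw [hL]
    unfold FreeGroup.IsReduced
    rw [List.isChain_append]
    refine ⟨hred, isReduced_mapWord (fun x _ y _ h => mul_left_cancel h) hred, ?_⟩
    intro x hx w hw
    obtain rfl : (f.right * y.1, y.2) = w := by simpa using hw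
    exact hcon x hx
  rw [Classical.not_imp] at hzy
  rcases L.eq_nil_or_concat with rfl | ⟨L, w, rfl⟩
  · obtain rfl : y = z := by simpa using hz
    exact absurd rfl hzy.2
  rw [List.concat_eq_append] at *
  obtain rfl : w = z := by
    rwa [← List.cons_append, List.getLast?_concat, Option.mem_some_iff] at hz
  have hf : f.left = FreeGroup.mk [y] * (FreeGroup.mk L * FreeGroup.mk [w]) := by
    rw [FreeGroup.mul_mk, FreeGroup.mul_mk, ← FreeGroup.mk_toWord (x := f.left), hL]
    rfl
  have hwy : FreeGroup.mk [w] * FreeGroup.mk [(f.right * y.1, y.2)] = 1 := by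
    have : w = (f.right * y.1, !y.2) := by
      rw [← hzy.1]
      refine Prod.ext rfl ?_
      have := hzy.2
      revert this
      cases w.2 <;> cases y.2 <;> simp
    rw [this, mul_eq_one_iff_eq_inv]
    rfl
  -- Conjugating away the first letter also cancels the last one, so the length drops and induction
  -- applies.
  have hf' : (inl (FreeGroup.mk [y])⁻¹ * f * (inl (FreeGroup.mk [y])⁻¹)⁻¹).left =
      FreeGroup.mk L := by
    rw [← map_inv, inv_inv]
    simp only [mul_left, left_inl, right_inl, map_one, MulAut.one_apply, mul_right, one_mul, hf,
      shift_apply, map_mk_eq, mapWord_cons, mapWord_nil]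
    rw [inv_mul_cancel_left, mul_assoc, hwy, mul_one]
  have hlt : (inl (FreeGroup.mk [y])⁻¹ * f * (inl (FreeGroup.mk [y])⁻¹)⁻¹).left.norm < n := by
    rw [hf', ← hn, FreeGroup.norm, FreeGroup.norm, hL]
    refine lt_of_le_of_lt (FreeGroup.norm_mk_le (L₁ := L)) ?_
    simp
  obtain ⟨x, hx⟩ := ih _ hlt _ rfl
  refine ⟨x * inl (FreeGroup.mk [y])⁻¹, ?_⟩
  simpa only [mul_inv_rev, mul_assoc] using hx

end FreeWreath
end FreeWreath
-- The free factors of the amalgam inside the semidirect product.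
namespace FreeWreath

open SemidirectProduct

section Factor

variable {P : Type*} [Group P] (α s : P)

/-- The homomorphism of a free group of rank two to `FreeWreath P` taking the free generators to
`α` and to the product of `s` and the generator of the infinite cyclic factor. -/
def factorHom : FreeGroup (Fin 2) →* FreeWreath P :=
  FreeGroup.lift ![inr α, inr s * inl (FreeGroup.of 1)]

/-- The word of the left component of the image of a word under `factorHom α s`, translated
by `β`. -/
def factorWord : P → List (Fin 2 × Bool) → List (P × Bool)
  | _, [] => []
  | β, (0, true) :: L => factorWord (β * α) L
  | β, (0, false) :: L => factorWord (β * α⁻¹) L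
  | β, (1, true) :: L => (β * s, true) :: factorWord (β * s) L
  | β, (1, false) :: L => (β, false) :: factorWord (β * s⁻¹) L

theorem shift_factorHom_left (β : P) (L : List (Fin 2 × Bool)) :
    shift P β (factorHom α s (FreeGroup.mk L)).left = FreeGroup.mk (factorWord α s β L) := by
  induction L generalizing β with
  | nil => simp [← FreeGroup.one_eq_mk, factorWord]
  | cons x L ih =>
    have hx : FreeGroup.mk (x :: L) = FreeGroup.mk [x] * FreeGroup.mk L := by
      rw [FreeGroup.mul_mk]; rfl
    rw [hx, map_mul, mul_left, map_mul, ← MulAut.mul_apply, ← map_mul, ih]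
    obtain ⟨i, e⟩ := x
    fin_cases i <;> cases e
    · change shift P β (factorHom α s (FreeGroup.of 0)⁻¹).left *
        FreeGroup.mk (factorWord α s (β * (factorHom α s (FreeGroup.of 0)⁻¹).right) L) =
        FreeGroup.mk (factorWord α s (β * α⁻¹) L)
      simp [factorHom]
    · change shift P β (factorHom α s (FreeGroup.of 0)).left *
        FreeGroup.mk (factorWord α s (β * (factorHom α s (FreeGroup.of 0)).right) L) =
        FreeGroup.mk (factorWord α s (β * α) L)
      simp [factorHom]
    · change shift P β (factorHom α s (FreeGroup.of 1)⁻¹).left *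
        FreeGroup.mk (factorWord α s (β * (factorHom α s (FreeGroup.of 1)⁻¹).right) L) =
        FreeGroup.mk ([(β, false)] ++ factorWord α s (β * s⁻¹) L)
      rw [← FreeGroup.mul_mk]
      simp [factorHom, shift_apply]
      rfl
    · change shift P β (factorHom α s (FreeGroup.of 1)).left *
        FreeGroup.mk (factorWord α s (β * (factorHom α s (FreeGroup.of 1)).right) L) =
        FreeGroup.mk ([(β * s, true)] ++ factorWord α s (β * s) L)
      rw [← FreeGroup.mul_mk]
      simp [factorHom, shift_apply]
      rfl

theorem factorHom_left (L : List (Fin 2 × Bool)) :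
    (factorHom α s (FreeGroup.mk L)).left = FreeGroup.mk (factorWord α s 1 L) := by
  rw [← shift_factorHom_left, map_one, MulAut.one_apply]

theorem factorWord_mul (β γ : P) (L : List (Fin 2 × Bool)) :
    factorWord α s (β * γ) L = mapWord (fun y => β * y) (factorWord α s γ L) := by
  induction L generalizing γ with
  | nil => rfl
  | cons x L ih =>
    obtain ⟨i, e⟩ := x
    fin_cases i <;> cases e <;> simp [factorWord, mul_assoc, ih]

theorem factorWord_append (β : P) (L L' : List (Fin 2 × Bool)) :
    factorWord α s β (L ++ L') = factorWord α s β L ++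
      factorWord α s (β * (factorHom α s (FreeGroup.mk L)).right) L' := by
  induction L generalizing β with
  | nil => simp [factorWord, ← FreeGroup.one_eq_mk]
  | cons x L ih =>
    have hx : FreeGroup.mk (x :: L) = FreeGroup.mk [x] * FreeGroup.mk L := by
      rw [FreeGroup.mul_mk]; rfl
    rw [hx, map_mul, mul_right, ← mul_assoc]
    obtain ⟨i, e⟩ := x
    fin_cases i <;> cases e <;> simp [factorWord, ih, factorHom]

theorem exists_zpow_of_factorWord_eq_nil {β : P} {L : List (Fin 2 × Bool)}
    (h : factorWord α s β L = []) : ∃ k : ℤ, FreeGroup.mk L = FreeGroup.of 0 ^ k := by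
  induction L generalizing β with
  | nil => exact ⟨0, by simp [FreeGroup.one_eq_mk]⟩
  | cons x L ih =>
    have hx : FreeGroup.mk (x :: L) = FreeGroup.mk [x] * FreeGroup.mk L := by
      rw [FreeGroup.mul_mk]; rfl
    obtain ⟨i, e⟩ := x
    fin_cases i <;> cases e
    · obtain ⟨k, hk⟩ := ih h
      refine ⟨-1 + k, ?_⟩
      rw [hx, hk, zpow_add, zpow_neg_one]
      rfl
    · obtain ⟨k, hk⟩ := ih h
      refine ⟨1 + k, ?_⟩
      rw [hx, hk, zpow_add, zpow_one]
      rfl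
    · simp [factorWord] at h
    · simp [factorWord] at h

/-- A reduced `L` starts with a block of equal letters `0` whose signed length is `k`. When `α` has
infinite order, cancellation in the image forces `k = 0`, and the first letter of `L` is then a
known letter `1`; this is how `isReduced_factorWord` reaches a contradiction. -/
theorem head?_factorWord {L : List (Fin 2 × Bool)} (hL : FreeGroup.IsReduced L) (β : P) :
    ∀ y ∈ (factorWord α s β L).head?, ∃ k : ℤ, y.1 = β * α ^ k * (if y.2 then s else 1) ∧
      (0 < k → L.head? = some (0, true)) ∧ (k < 0 → L.head? = some (0, false)) ∧
      (k = 0 → L.head? = some (1, y.2)) := by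
  induction L generalizing β with
  | nil => intro y hy; simp [factorWord] at hy
  | cons x L ih =>
    intro y hy
    have ih := ih (hL.infix ⟨[x], [], by simp⟩)
    have hx : ∀ z, L.head? = some z → x.1 = z.1 → x.2 = z.2 := by
      intro z hz
      obtain ⟨L', rfl⟩ := List.head?_eq_some_iff.1 hz
      exact (FreeGroup.isReduced_cons_cons.1 hL).1
    obtain ⟨i, e⟩ := x
    fin_cases i <;> cases e
    · obtain ⟨k, h1, h2, h3, h4⟩ := ih _ y hy
      have hk : k ≤ 0 := by
        by_contra hk
        simpa using hx _ (h2 (by omega)) rfl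
      refine ⟨-1 + k, ?_, fun h => by omega, fun _ => rfl, fun h => by omega⟩
      rw [h1, zpow_add, zpow_neg_one]
      simp only [mul_assoc]
    · obtain ⟨k, h1, h2, h3, h4⟩ := ih _ y hy
      have hk : 0 ≤ k := by
        by_contra hk
        simpa using hx _ (h3 (by omega)) rfl
      refine ⟨1 + k, ?_, fun _ => rfl, fun h => by omega, fun h => by omega⟩
      rw [h1, zpow_add, zpow_one]
      simp only [mul_assoc]
    · obtain rfl : (β, false) = y := by simpa [factorWord] using hy
      exact ⟨0, by simp, by simp, by simp, by simp⟩
    · obtain rfl : (β * s, true) = y := by simpa [factorWord] using hy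
      exact ⟨0, by simp, by simp, by simp, by simp⟩

variable {α} in
theorem isReduced_factorWord (hα : ∀ k : ℤ, α ^ k = 1 → k = 0) {L : List (Fin 2 × Bool)}
    (hL : FreeGroup.IsReduced L) (β : P) : FreeGroup.IsReduced (factorWord α s β L) := by
  have hcons : ∀ (y : P × Bool) (V : List (P × Bool)), FreeGroup.IsReduced V →
      (∀ z ∈ V.head?, y.1 = z.1 → y.2 = z.2) → FreeGroup.IsReduced (y :: V) := by
    intro y V hV h
    cases V with
    | nil => exact FreeGroup.IsReduced.singleton
    | cons z V => exact FreeGroup.isReduced_cons_cons.2 ⟨h z rfl, hV⟩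
  induction L generalizing β with
  | nil => exact FreeGroup.IsReduced.nil
  | cons x L ih =>
    have hL' : FreeGroup.IsReduced L := hL.infix ⟨[x], [], by simp⟩
    have hx : ∀ z, L.head? = some z → x.1 = z.1 → x.2 = z.2 := by
      intro z hz
      obtain ⟨L', rfl⟩ := List.head?_eq_some_iff.1 hz
      exact (FreeGroup.isReduced_cons_cons.1 hL).1
    have ih := ih hL'
    obtain ⟨i, e⟩ := x
    fin_cases i <;> cases e
    · exact ih _
    · exact ih _
    · refine hcons _ _ (ih _) fun z hz hβ => ?_
      obtain ⟨k, h1, -, -, h4⟩ := head?_factorWord α s hL' _ z hz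
      by_contra hz2
      have hz2' : z.2 = true := by simpa using hz2
      rw [hz2', if_pos rfl, ← show β = z.1 from hβ] at h1
      have h5 : s⁻¹ * α ^ k * s = 1 := by
        rw [mul_assoc, mul_assoc] at h1
        simpa [mul_assoc] using h1
      have h6 : α ^ k = 1 := by
        rw [mul_assoc, inv_mul_eq_one] at h5
        simpa using h5.symm
      have := hx _ (h4 (hα k h6)) rfl
      simp [hz2'] at this
    · refine hcons _ _ (ih _) fun z hz hβ => ?_
      obtain ⟨k, h1, -, -, h4⟩ := head?_factorWord α s hL' _ z hz
      by_contra hz2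
      have hz2' : z.2 = false := by simpa using Ne.symm hz2
      rw [hz2', ← show β * s = z.1 from hβ] at h1
      have h6 : α ^ k = 1 := by simpa using h1
      have := hx _ (h4 (hα k h6)) rfl
      simp [hz2'] at this

variable {α s} (hα : ∀ k : ℤ, α ^ k = 1 → k = 0)
include hα

theorem exists_zpow_of_factorHom_left_eq_one {g : FreeGroup (Fin 2)}
    (h : (factorHom α s g).left = 1) : ∃ k : ℤ, g = FreeGroup.of 0 ^ k := by
  rw [← FreeGroup.mk_toWord (x := g), factorHom_left] at h
  by_contra hg
  refine mk_ne_one_of_isReduced (isReduced_factorWord s hα FreeGroup.isReduced_toWord 1) ?_ h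
  intro hnil
  obtain ⟨k, hk⟩ := exists_zpow_of_factorWord_eq_nil α s hnil
  exact hg ⟨k, by rw [← hk, FreeGroup.mk_toWord]⟩

theorem factorHom_injective : Function.Injective (factorHom α s) := by
  rw [injective_iff_map_eq_one]
  intro g hg
  obtain ⟨k, rfl⟩ := exists_zpow_of_factorHom_left_eq_one hα (congrArg SemidirectProduct.left hg)
  have h := congrArg SemidirectProduct.right hg
  rw [hα k]
  · simp
  · rw [map_zpow, factorHom, FreeGroup.lift_apply_of, Matrix.cons_val_zero, ← map_zpow] at h
    exact h

/-- A cyclic subgroup of the free group of rank two that is not conjugate to a subgroup of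
`⟨of 0⟩` has a closed image. -/
theorem exists_conj_zpow_or_proClosed (hP : ProClosed ({1} : Set P)) (f : FreeGroup (Fin 2)) :
    (∃ (x : FreeGroup (Fin 2)) (k : ℤ), f = x * FreeGroup.of 0 ^ k * x⁻¹) ∨
      ProClosed (Subgroup.zpowers (factorHom α s f) : Set (FreeWreath P)) := by
  have hc := FreeGroup.reduceCyclically.isCyclicallyReduced (FreeGroup.isReduced_toWord (x := f))
  have hf := FreeGroup.reduceCyclically.conj_conjugator_reduceCyclically f.toWord
  generalize FreeGroup.reduceCyclically f.toWord = L at hc hf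
  have hf : f = FreeGroup.mk (FreeGroup.reduceCyclically.conjugator f.toWord) * FreeGroup.mk L *
      (FreeGroup.mk (FreeGroup.reduceCyclically.conjugator f.toWord))⁻¹ := by
    rw [FreeGroup.inv_mk, FreeGroup.mul_mk, FreeGroup.mul_mk, hf, FreeGroup.mk_toWord]
  by_cases h : factorWord α s 1 L = []
  · obtain ⟨k, hk⟩ := exists_zpow_of_factorWord_eq_nil α s h
    left
    rw [hk] at hf
    exact ⟨_, k, hf⟩
  · right
    have hs : Straight (factorHom α s (FreeGroup.mk L)) (factorWord α s 1 L) := by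
      refine ⟨factorHom_left α s L, h, ?_⟩
      -- `L` is cyclically reduced, so `L L` is reduced; its image word is that of `L` followed by
      -- its translate, which is what straightness asks about.
      have h2 := isReduced_factorWord s hα (hc.flatten_replicate 2).isReduced 1
      rw [List.replicate_succ, List.replicate_one, List.flatten_cons, List.flatten_cons,
        List.flatten_nil, List.append_nil, factorWord_append, one_mul] at h2
      rwa [← factorWord_mul, mul_one]
    rw [hf, map_mul, map_mul, map_inv]
    exact (hs.proClosed_zpowers hP).zpowers_conj _

end Factor

/-- Other powers of the first generator are separated by the action of `BS` on `ZMod |k|`, available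
because `k` is odd. Any other `g` has nontrivial left component, unlike the elements of the
subgroup. -/
theorem exists_separating_normal_of_odd (s : BS) {k : ℤ} (hk : Odd k) {g : FreeGroup (Fin 2)}
    (hg : g ∉ Subgroup.zpowers (FreeGroup.of 0 ^ k)) :
    ∃ M : Subgroup (FreeWreath BS), M.Normal ∧ M.FiniteIndex ∧
      ∀ x ∈ Subgroup.zpowers (FreeGroup.of 0 ^ k : FreeGroup (Fin 2)),
        (factorHom BS.a s x)⁻¹ * factorHom BS.a s g ∉ M := by
  have ha : ∀ l : ℤ, factorHom BS.a s (FreeGroup.of 0 ^ l) = inr (BS.a ^ l) := by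
    intro l
    rw [map_zpow, map_zpow, factorHom, FreeGroup.lift_apply_of, Matrix.cons_val_zero]
  by_cases h : (factorHom BS.a s g).left = 1
  · obtain ⟨l, rfl⟩ := exists_zpow_of_factorHom_left_eq_one
      (fun k => BS.a_zpow_eq_one_iff.1) h
    have hkl : ¬ k ∣ l := by
      rintro ⟨m, rfl⟩
      exact hg ⟨m, (zpow_mul _ _ _).symm⟩
    have hn : Nat.Coprime 2 k.natAbs := by
      rw [Nat.coprime_two_left]
      exact Int.natAbs_odd.2 hk
    have : NeZero k.natAbs := ⟨by
      rintro h0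
      rw [Int.natAbs_eq_zero] at h0
      subst h0
      simp at hk⟩
    refine ⟨((BS.toPerm k.natAbs hn).comp rightHom).ker, inferInstance, inferInstance, ?_⟩
    rintro _ ⟨m, rfl⟩ hm
    change (factorHom BS.a s ((FreeGroup.of 0 ^ k) ^ m))⁻¹ * _ ∈ _ at hm
    rw [← zpow_mul, ha, ha, ← map_inv, ← map_mul, MonoidHom.mem_ker, MonoidHom.comp_apply,
      rightHom_inr, ← zpow_neg, ← zpow_add, BS.toPerm_a_zpow_eq_one_iff, Int.natAbs_dvd] at hm
    exact hkl ((dvd_add_right (Dvd.intro m rfl).neg_right).1 hm)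
  · obtain ⟨M, h1, h2, h3⟩ := exists_normal_of_left_ne_one BS.proClosed_one (BS.a ^ k) h
    refine ⟨M, h1, h2, ?_⟩
    rintro _ ⟨m, rfl⟩
    refine h3 _ ⟨m, ?_⟩
    change inr (BS.a ^ k) ^ m = factorHom BS.a s ((FreeGroup.of 0 ^ k) ^ m)
    rw [map_zpow (factorHom BS.a s), ha]

/-- A cyclic subgroup of the free group of rank two, not conjugate to a nontrivial subgroup of
`⟨of 0 ^ 2⟩`, is separated from all other elements by finite quotients of `FreeWreath BS`. -/
theorem exists_separating_normal (s : BS) {f g : FreeGroup (Fin 2)}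
    (hf : ∀ (x : FreeGroup (Fin 2)) (k : ℤ), k ≠ 0 → f ≠ x * FreeGroup.of 0 ^ (2 * k) * x⁻¹)
    (hg : g ∉ Subgroup.zpowers f) :
    ∃ M : Subgroup (FreeWreath BS), M.Normal ∧ M.FiniteIndex ∧
      ∀ x ∈ Subgroup.zpowers f, (factorHom BS.a s x)⁻¹ * factorHom BS.a s g ∉ M := by
  have hα : ∀ k : ℤ, BS.a ^ k = 1 → k = 0 := fun k => BS.a_zpow_eq_one_iff.1
  have hclosed : ProClosed (Subgroup.zpowers (factorHom BS.a s f) : Set (FreeWreath BS)) →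
      ∃ M : Subgroup (FreeWreath BS), M.Normal ∧ M.FiniteIndex ∧
        ∀ x ∈ Subgroup.zpowers f, (factorHom BS.a s x)⁻¹ * factorHom BS.a s g ∉ M := by
    intro h
    obtain ⟨M, h1, h2, h3⟩ := h (factorHom BS.a s g) (by
      rintro ⟨k, hk : _ ^ k = _⟩
      rw [← map_zpow] at hk
      exact hg ⟨k, factorHom_injective hα hk⟩)
    refine ⟨M, h1, h2, ?_⟩
    rintro _ ⟨k, rfl⟩
    exact h3 _ ⟨k, (map_zpow _ _ _).symm⟩
  rcases exists_conj_zpow_or_proClosed (s := s) hα BS.proClosed_one f with ⟨x, k, rfl⟩ | h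
  · rcases k.even_or_odd with ⟨m, hm⟩ | hk
    · rw [← two_mul] at hm
      have hm0 : m = 0 := by
        by_contra hm0
        exact hf x m hm0 (by rw [hm])
      apply hclosed
      have := proClosed_zpowers_inr BS.proClosed_one (BS.proClosed_zpowers (Or.inl rfl))
      simpa [hm, hm0] using this
    · obtain ⟨M, h1, h2, h3⟩ := exists_separating_normal_of_odd s hk (g := x⁻¹ * g * x) (by
        rintro ⟨m, hm : _ ^ m = _⟩
        refine hg ⟨m, ?_⟩
        change (x * FreeGroup.of 0 ^ k * x⁻¹) ^ m = g
        rw [conj_zpow, hm]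
        group)
      refine ⟨M, h1, h2, ?_⟩
      rintro _ ⟨m, rfl⟩ hm
      refine h3 _ ⟨m, rfl⟩ ?_
      have := h1.conj_mem _ hm (factorHom BS.a s x)⁻¹
      convert this using 1
      simp only [conj_zpow, map_mul, map_inv]
      group
  · exact hclosed h

end FreeWreath

/-! ### The isomorphism of `G` with the free product of `BS` and an infinite cyclic group. -/

section Presentation

open SemidirectProduct

theorem G_relations : (PresentedGroup.of Gen.a : G) = PresentedGroup.of Gen.c ∧
    (PresentedGroup.of Gen.b : G)⁻¹ * PresentedGroup.of Gen.a * PresentedGroup.of Gen.b =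
      (PresentedGroup.of Gen.d)⁻¹ * PresentedGroup.of Gen.c ^ 2 * PresentedGroup.of Gen.d := by
  constructor
  · have h := PresentedGroup.one_of_mem (rels := relators) (Set.mem_insert _ _)
    rw [map_mul, map_inv, mul_inv_eq_one] at h
    exact h
  · have h := PresentedGroup.one_of_mem (rels := relators)
      (Set.mem_insert_of_mem _ (Set.mem_singleton _))
    rw [map_mul, map_inv, mul_inv_eq_one] at h
    simp only [map_mul, map_inv, map_pow] at h
    exact h

/-- The images in `FreeWreath BS` of the generators of `G`. -/
def genImage : Gen → FreeWreath BS
  | Gen.a => inr BS.a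
  | Gen.b => inr BS.t * inl (FreeGroup.of 1)
  | Gen.c => inr BS.a
  | Gen.d => inr 1 * inl (FreeGroup.of 1)

/-- The homomorphism of `G` to `FreeWreath BS`. -/
def toWreath : G →* FreeWreath BS :=
  PresentedGroup.toGroup (f := genImage) (by
    rintro r (rfl | rfl)
    · simp [genImage]
    · have h : (inr BS.t : FreeWreath BS)⁻¹ * inr BS.a * inr BS.t = inr BS.a ^ 2 := by
        rw [← map_inv, ← map_mul, ← map_mul, BS.rel, map_pow]
      rw [map_mul, map_inv, mul_inv_eq_one]
      simp only [map_mul, map_inv, map_pow, FreeGroup.lift_apply_of, genImage, map_one, one_mul,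
        mul_inv_rev]
      rw [← h]
      group)

/-- The homomorphism of `BS` to `G` with `a ↦ a`, `t ↦ b d⁻¹`. -/
def bsToG : BS →* G :=
  BS.lift (PresentedGroup.of Gen.a) (PresentedGroup.of Gen.b * (PresentedGroup.of Gen.d)⁻¹) (by
    obtain ⟨h1, h2⟩ := G_relations
    calc _ = PresentedGroup.of Gen.d * ((PresentedGroup.of Gen.b : G)⁻¹ *
          PresentedGroup.of Gen.a * PresentedGroup.of Gen.b) * (PresentedGroup.of Gen.d)⁻¹ := by
          group
      _ = _ := by rw [h2, h1]; group)

/-- The homomorphism of `FreeWreath BS` to `G`, the inverse of `toWreath`. -/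
def ofWreath : FreeWreath BS →* G :=
  SemidirectProduct.lift
    (FreeGroup.lift fun β => bsToG β * PresentedGroup.of Gen.d * (bsToG β)⁻¹) bsToG (by
      intro β
      ext
      simp [shift_apply, mul_assoc])

/-- The group `G` is the free product of `BS` and an infinite cyclic group. -/
def wreathEquiv : G ≃* FreeWreath BS :=
  MonoidHom.toMulEquiv toWreath ofWreath
    (by
      apply PresentedGroup.ext
      intro x
      cases x <;> simp [toWreath, genImage, ofWreath, bsToG, PresentedGroup.toGroup.of,
        G_relations.1])
    (by
      have h : toWreath.comp bsToG = inr := by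
        apply BS.hom_ext <;> simp [bsToG, toWreath, genImage, PresentedGroup.toGroup.of]
      have h' : ∀ β, toWreath (bsToG β) = inr β := fun β => DFunLike.congr_fun h β
      apply SemidirectProduct.hom_ext
      · ext1 β
        have h1 : shift BS β (FreeGroup.of 1) = FreeGroup.of β := by simp [shift_apply]
        have h2 := inl_aut (φ := shift BS) β (FreeGroup.of 1)
        rw [h1] at h2
        have h3 : toWreath (PresentedGroup.of Gen.d) = inl (FreeGroup.of 1) := by
          simp [toWreath, genImage, PresentedGroup.toGroup.of]
        simp [ofWreath, h', h3, h2]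
      · ext1 β
        simp [ofWreath, h'])

theorem wreathEquiv_ιA (x : A) : wreathEquiv (ιA x) = FreeWreath.factorHom BS.a BS.t x := by
  have : toWreath.comp ιA = FreeWreath.factorHom BS.a BS.t := by
    ext1 i
    fin_cases i <;> simp [ιA, FreeWreath.factorHom, toWreath, genImage, PresentedGroup.toGroup.of]
  exact DFunLike.congr_fun this x

theorem wreathEquiv_ιB (x : B) : wreathEquiv (ιB x) = FreeWreath.factorHom BS.a 1 x := by
  have : toWreath.comp ιB = FreeWreath.factorHom BS.a 1 := by
    ext1 i
    fin_cases i <;> simp [ιB, FreeWreath.factorHom, toWreath, genImage, PresentedGroup.toGroup.of]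
  exact DFunLike.congr_fun this x

end Presentation
-- Criterion for nonseparable cyclic subgroups of a free factor.
open scoped Pointwise in
theorem separableBy_iff {X : Type*} [Group X] {Ψ : Set (Subgroup X)} {F : Subgroup X} :
    SeparableBy Ψ F ↔ ∀ g, g ∉ F → ∃ N ∈ Ψ, ∀ x ∈ F, x⁻¹ * g ∉ N := by
  have hmem : ∀ (g : X) (N : Subgroup X),
      g ∈ (F : Set X) * (N : Set X) ↔ ∃ x ∈ F, x⁻¹ * g ∈ N := by
    intro g N
    constructor
    · rintro ⟨x, hx, y, hy, rfl⟩
      exact ⟨x, hx, by simpa using hy⟩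
    · rintro ⟨x, hx, hy⟩
      exact ⟨x, hx, _, hy, by simp⟩
  constructor
  · intro h g hg
    by_contra! hcon
    refine hg (h.subset (Set.mem_iInter₂.2 fun N hN => ?_))
    exact (hmem g N).2 (hcon N hN)
  · intro h
    refine Set.Subset.antisymm (fun g hg => ?_) (fun g hg => Set.mem_iInter₂.2 fun N _ => ?_)
    · by_contra hgF
      obtain ⟨N, hN, hx⟩ := h g hgF
      obtain ⟨x, hxF, hxN⟩ := (hmem g N).1 (Set.mem_iInter₂.1 hg N hN)
      exact hx x hxF hxN
    · exact (hmem g N).2 ⟨g, hg, by simp⟩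

theorem map_conj_zpowers {X : Type*} [Group X] (x y : X) :
    (Subgroup.zpowers y).map (MulAut.conj x).toMonoidHom = Subgroup.zpowers (x * y * x⁻¹) := by
  rw [MonoidHom.map_zpowers]
  rfl

theorem exists_eq_zpowers {X : Type*} [Group X] {F : Subgroup X} (h : IsCyclic F) :
    ∃ f, F = Subgroup.zpowers f := by
  obtain ⟨f, hf⟩ := F.isCyclic_iff_exists_zpowers_eq_top.1 h
  exact ⟨f, hf.symm⟩

/-- The cyclic subgroups of the free group of rank two that are not separable by a family that
contains the preimages of the normal subgroups of finite index of `FreeWreath BS`, all of whose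
members contain an odd power of the first free generator. -/
theorem isCyclic_and_not_separableBy_iff (s : BS) {Ψ : Set (Subgroup (FreeGroup (Fin 2)))}
    (hΨ : ∀ M : Subgroup (FreeWreath BS), M.Normal → M.FiniteIndex →
      M.comap (FreeWreath.factorHom BS.a s) ∈ Ψ)
    (hodd : ∀ N ∈ Ψ, N.Normal ∧ ∃ n : ℤ, Odd n ∧ FreeGroup.of 0 ^ n ∈ N)
    (F : Subgroup (FreeGroup (Fin 2))) :
    (IsCyclic F ∧ ¬ SeparableBy Ψ F) ↔
      ∃ k : ℤ, k ≠ 0 ∧ ConjSubgroups F (Subgroup.zpowers (FreeGroup.of 0 ^ (2 * k))) := by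
  constructor
  · rintro ⟨hF, hsep⟩
    obtain ⟨f, rfl⟩ := exists_eq_zpowers hF
    by_contra! hcon
    refine hsep (separableBy_iff.2 fun g hg => ?_)
    obtain ⟨M, h1, h2, h3⟩ := FreeWreath.exists_separating_normal s
      (f := f) (by
        rintro x k hk rfl
        exact hcon k hk ⟨x, (map_conj_zpowers _ _).symm⟩) hg
    exact ⟨_, hΨ M h1 h2, fun x hx hm => h3 x hx (by simpa using hm)⟩
  · rintro ⟨k, hk, x, hF⟩
    rw [map_conj_zpowers] at hF
    subst hF
    refine ⟨inferInstance, fun hsep => ?_⟩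
    -- This element is outside `F`, since its exponent sum `k` is no multiple of `2k`. It lies in `F
    -- N` for every `N`: if `n = 2m + 1` and the `n`-th power of the generator is in `N`, then `k =
    -- 2k(-m) + nk`.
    obtain ⟨N, hN, h⟩ := separableBy_iff.1 hsep (x * FreeGroup.of 0 ^ k * x⁻¹) (by
      rintro ⟨m, hm : _ ^ m = _⟩
      rw [conj_zpow, mul_left_inj, mul_right_inj, ← zpow_mul] at hm
      have h1 := congrArg (FreeGroup.lift fun _ : Fin 2 => Multiplicative.ofAdd (1 : ℤ)) hm
      have h2 : 2 * k * m = k := by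
        simp only [map_zpow, FreeGroup.lift_apply_of, ← ofAdd_zsmul] at h1
        rw [Multiplicative.ofAdd.injective.eq_iff, smul_eq_mul, smul_eq_mul, mul_one] at h1
        linarith
      have h3 : k * (2 * m - 1) = 0 := by linarith
      rcases mul_eq_zero.1 h3 with h4 | h4
      · exact hk h4
      · omega)
    obtain ⟨hNn, n, ⟨m, hm⟩, hn⟩ := hodd N hN
    refine h _ ⟨-m, rfl⟩ ?_
    have h1 := hNn.conj_mem _ (N.zpow_mem hn k) x
    convert h1 using 1
    change ((x * FreeGroup.of 0 ^ (2 * k) * x⁻¹) ^ (-m))⁻¹ * _ = _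
    rw [conj_zpow, ← zpow_mul, ← zpow_mul, hm]
    have : (2 * m + 1) * k = 2 * k * m + k := by ring
    rw [this, zpow_add, mul_neg, zpow_neg]
    group

/-! ### Compatible pairs, the nonseparable subgroups, and separability in `G`. -/

section Families

theorem a_mem_H : a ∈ H := Subgroup.subset_closure (Set.mem_insert _ _)

theorem conj_a_mem_H : b⁻¹ * a * b ∈ H :=
  Subgroup.subset_closure (Set.mem_insert_of_mem _ (Set.mem_singleton _))

theorem ιA_eq_ιB_φ (h : H) : ιA h = ιB (φ h) := by
  obtain ⟨x, hx⟩ := h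
  have hx' : x ∈ toH.range := range_toH ▸ hx
  obtain ⟨w, rfl⟩ := hx'
  rw [φ_toH]
  have : ιA.comp toH = ιB.comp toK := by
    obtain ⟨h1, h2⟩ := G_relations
    ext1 i
    fin_cases i
    · simpa [ιA, ιB, toH, toK, a, c] using h1
    · simpa [ιA, ιB, toH, toK, a, b, c, d] using h2
  exact DFunLike.congr_fun this w

/-- Compatibility holds because `ιA` and `ιB ∘ φ` agree on `H`. Thus finite quotients of `G` supply
all the members of the families needed for separation. -/
theorem comap_mem_Omega {N : Subgroup G} (h1 : N.Normal) (h2 : N.FiniteIndex) :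
    (N.comap ιA, N.comap ιB) ∈ Omega φ := by
  refine ⟨h1.comap _, h1.comap _, finiteIndex_comap _ _, finiteIndex_comap _ _, ?_⟩
  ext y
  simp only [Subgroup.mem_map, Subgroup.mem_subgroupOf, Subgroup.mem_comap]
  constructor
  · rintro ⟨h, hh, rfl⟩
    rw [ιA_eq_ιB_φ] at hh
    exact hh
  · intro hy
    refine ⟨φ.symm y, ?_, φ.apply_symm_apply y⟩
    rwa [ιA_eq_ιB_φ, MulEquiv.apply_symm_apply]

theorem Compatible.mem_iff {A B : Type*} [Group A] [Group B] {H : Subgroup A} {K : Subgroup B}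
    {φ : H ≃* K} {R : Subgroup A} {S : Subgroup B} (h : Compatible φ R S) (x : H) :
    (x : A) ∈ R ↔ (φ x : B) ∈ S := by
  rw [← Subgroup.mem_subgroupOf, ← Subgroup.mem_subgroupOf, ← h]
  exact (Subgroup.mem_map_iff_mem φ.injective).symm

theorem conj_mem_iff {X : Type*} [Group X] {N : Subgroup X} (hN : N.Normal) (g x : X) :
    g * x * g⁻¹ ∈ N ↔ x ∈ N := by
  refine ⟨fun h => ?_, fun h => hN.conj_mem x h g⟩
  simpa [mul_assoc] using hN.conj_mem _ h g⁻¹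

/-- The two generators of `H` give `a^j ∈ R ↔ c^j ∈ S` and, by normality, `a^j ∈ R ↔ c^(2j) ∈ S`.
Hence `a^(2j) ∈ R` implies `a^j ∈ R`, and an exponent supplied by the finite index of `R` can be
halved until it is odd. -/
theorem exists_odd_pow_mem {R : Subgroup A} {S : Subgroup B} (h : (R, S) ∈ Omega φ) :
    ∃ n : ℤ, Odd n ∧ a ^ n ∈ R ∧ c ^ n ∈ S := by
  obtain ⟨hR, hS, hRf, -, hc⟩ := h
  have h1 : ∀ j : ℤ, a ^ j ∈ R ↔ c ^ j ∈ S := by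
    intro j
    have := hc.mem_iff (⟨a, a_mem_H⟩ ^ j)
    rwa [map_zpow, Subgroup.coe_zpow, Subgroup.coe_zpow,
      (φ_generators a_mem_H conj_a_mem_H).1] at this
  have h2 : ∀ j : ℤ, a ^ j ∈ R ↔ c ^ (2 * j) ∈ S := by
    intro j
    have := hc.mem_iff (⟨b⁻¹ * a * b, conj_a_mem_H⟩ ^ j)
    rw [map_zpow, Subgroup.coe_zpow, Subgroup.coe_zpow,
      (φ_generators a_mem_H conj_a_mem_H).2] at this
    have ha : (b⁻¹ * a * b) ^ j = b⁻¹ * a ^ j * b⁻¹⁻¹ := by rw [← conj_zpow, inv_inv]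
    have hc : (d⁻¹ * c ^ 2 * d) ^ j = d⁻¹ * c ^ (2 * j) * d⁻¹⁻¹ := by
      rw [zpow_mul, ← conj_zpow, inv_inv]
      rfl
    rw [ha, hc] at this
    exact (conj_mem_iff hR _ _).symm.trans (this.trans (conj_mem_iff hS _ _))
  have h3 : ∀ n : ℕ, n ≠ 0 → a ^ (n : ℤ) ∈ R → ∃ m : ℤ, Odd m ∧ a ^ m ∈ R := by
    intro n
    induction n using Nat.strong_induction_on with
    | _ n ih =>
    intro hn hm
    rcases n.even_or_odd with ⟨j, hj⟩ | hodd
    · refine ih j (by omega) (by omega) ?_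
      rw [h2, ← h1]
      convert hm using 2
      omega
    · exact ⟨n, by exact_mod_cast hodd, hm⟩
  obtain ⟨n, hn, -, hm⟩ := R.exists_pow_mem_of_index_ne_zero hRf.index_ne_zero a
  obtain ⟨m, hodd, hm⟩ := h3 n hn.ne' (by rwa [zpow_natCast])
  exact ⟨m, hodd, hm, (h1 m).1 hm⟩

theorem comap_comap_wreathEquiv {ι : FreeGroup (Fin 2) →* G} {s : BS}
    (hι : ∀ x, wreathEquiv (ι x) = FreeWreath.factorHom BS.a s x)
    (M : Subgroup (FreeWreath BS)) :
    (M.comap wreathEquiv.toMonoidHom).comap ι = M.comap (FreeWreath.factorHom BS.a s) := by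
  ext x
  change wreathEquiv (ι x) ∈ M ↔ _
  rw [hι]
  rfl

theorem mem_LambdaA_iff (F : Subgroup A) : F ∈ LambdaA φ ↔
    ∃ k : ℤ, k ≠ 0 ∧ ConjSubgroups F (Subgroup.zpowers (a ^ (2 * k))) := by
  refine isCyclic_and_not_separableBy_iff BS.t (fun M h1 h2 => ?_) ?_ F
  · rw [← comap_comap_wreathEquiv wreathEquiv_ιA]
    exact ⟨_, comap_mem_Omega (h1.comap _) (finiteIndex_comap _ _), rfl⟩
  · rintro _ ⟨⟨R, S⟩, h, rfl⟩
    obtain ⟨n, hn, hm, -⟩ := exists_odd_pow_mem h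
    exact ⟨h.1, n, hn, hm⟩

theorem mem_LambdaB_iff (F : Subgroup B) : F ∈ LambdaB φ ↔
    ∃ k : ℤ, k ≠ 0 ∧ ConjSubgroups F (Subgroup.zpowers (c ^ (2 * k))) := by
  refine isCyclic_and_not_separableBy_iff 1 (fun M h1 h2 => ?_) ?_ F
  · rw [← comap_comap_wreathEquiv wreathEquiv_ιB]
    exact ⟨_, comap_mem_Omega (h1.comap _) (finiteIndex_comap _ _), rfl⟩
  · rintro _ ⟨⟨R, S⟩, h, rfl⟩
    obtain ⟨n, hn, -, hm⟩ := exists_odd_pow_mem h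
    exact ⟨h.2.1, n, hn, hm⟩

theorem conjSubgroups_refl {X : Type*} [Group X] (F : Subgroup X) : ConjSubgroups F F := by
  refine ⟨1, ?_⟩
  rw [map_one]
  exact (Subgroup.map_id F).symm

open SemidirectProduct in
theorem cyclicSeparableOutsideLambda : CyclicSeparableOutsideLambda φ ιA ιB := by
  intro F hF hconj
  obtain ⟨f, rfl⟩ := exists_eq_zpowers hF
  obtain ⟨x, hx⟩ := FreeWreath.exists_conj_straight (wreathEquiv f)
  have hclosed : ProClosed
      (Subgroup.zpowers (x * wreathEquiv f * x⁻¹) : Set (FreeWreath BS)) := by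
    rcases hx with ⟨β, hβ⟩ | ⟨L, hL⟩
    · rw [hβ]
      refine FreeWreath.proClosed_zpowers_inr BS.proClosed_one (BS.proClosed_zpowers ?_)
      by_contra! hcon
      obtain ⟨i, k, rfl⟩ := BS.exists_eq_of_tExp_eq_one hcon.2
      have hk : k ≠ 0 := by
        rintro rfl
        exact hcon.1 (by simp)
      -- Since `a^k = t a^(2k) t⁻¹`, the element `t^i a^k t^(-i)` is conjugate to `a^(2k)` even for
      -- odd `k`; this accounts for the exponent `i + 1`.
      refine hconj ((Subgroup.zpowers (a ^ (2 * k))).map ιA) (Or.inl ⟨_, ?_, rfl⟩)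
        ⟨wreathEquiv.symm (x⁻¹ * inr (BS.t ^ (i + 1))), ?_⟩
      · exact (mem_LambdaA_iff _).2 ⟨k, hk, conjSubgroups_refl _⟩
      · rw [MonoidHom.map_zpowers, map_conj_zpowers]
        congr 1
        apply wreathEquiv.injective
        have ht := BS.a_zpow_mul_t_pow k 1
        rw [pow_one, pow_one] at ht
        have ha : wreathEquiv (ιA (a ^ (2 * k))) = inr (BS.a ^ (2 * k)) := by
          rw [wreathEquiv_ιA, map_zpow, map_zpow, a, FreeWreath.factorHom,
            FreeGroup.lift_apply_of, Matrix.cons_val_zero]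
        have hβ' : BS.t ^ i * BS.a ^ k * (BS.t ^ i)⁻¹ =
            BS.t ^ (i + 1) * BS.a ^ (2 * k) * (BS.t ^ (i + 1))⁻¹ := by
          rw [pow_succ, mul_assoc (BS.t ^ i) BS.t, ← ht]
          group
        rw [hβ'] at hβ
        rw [map_mul, map_mul, map_inv, MulEquiv.apply_symm_apply, ha]
        calc wreathEquiv f = x⁻¹ * (x * wreathEquiv f * x⁻¹) * x := by group
          _ = _ := by
            rw [hβ]
            simp only [map_mul, map_inv, mul_inv_rev, inv_inv, mul_assoc]
    · exact hL.proClosed_zpowers BS.proClosed_one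
  have h1 := (hclosed.zpowers_conj x⁻¹).preimage wreathEquiv.toMonoidHom
  apply ProClosed.finitelySeparable
  convert h1 using 1
  ext y
  have h2 : x⁻¹ * (x * wreathEquiv f * x⁻¹) * x⁻¹⁻¹ = wreathEquiv f := by group
  rw [h2]
  simp only [SetLike.mem_coe, Set.mem_preimage, Subgroup.mem_zpowers_iff]
  refine exists_congr fun k => ?_
  rw [← map_zpow]
  exact wreathEquiv.injective.eq_iff.symm

theorem conj_c_notMem_K : d⁻¹ * c * d ∉ K := by
  intro h
  -- Here `c` fixes `0` and `c²` acts trivially, so `K` fixes `0`, whereas `d⁻¹ c d` takes `0` to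
  -- `2`.
  let ρ : B →* Equiv.Perm (Fin 3) := FreeGroup.lift ![Equiv.swap 1 2, Equiv.swap 0 1]
  have hK : K ≤ (MulAction.stabilizer (Equiv.Perm (Fin 3)) (0 : Fin 3)).comap ρ := by
    rw [K, Subgroup.closure_le]
    rintro x (rfl | rfl)
    · change ρ c 0 = 0
      simp only [ρ, c, FreeGroup.lift_apply_of]
      decide
    · change ρ (d⁻¹ * c ^ 2 * d) 0 = 0
      simp only [ρ, c, d, map_mul, map_inv, map_pow, FreeGroup.lift_apply_of]
      decide
  have h1 : ρ (d⁻¹ * c * d) 0 = 0 := hK h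
  simp only [ρ, c, d, map_mul, map_inv, FreeGroup.lift_apply_of] at h1
  revert h1
  decide

/-- Some odd power `c^(2m+1)` lies in `S`, so modulo `S` the element `d⁻¹ c d` equals `(d⁻¹ c²
d)^(-m)`, which is in `K`. -/
theorem not_isFiltrationFor_OmegaB : ¬ IsFiltrationFor (OmegaB φ) K := by
  rintro ⟨-, h⟩
  obtain ⟨_, ⟨⟨R, S⟩, hRS, rfl⟩, hS⟩ := separableBy_iff.1 h _ conj_c_notMem_K
  obtain ⟨n, ⟨m, hm⟩, -, hn⟩ := exists_odd_pow_mem hRS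
  have hK : d⁻¹ * c ^ 2 * d ∈ K :=
    Subgroup.subset_closure (Set.mem_insert_of_mem _ (Set.mem_singleton _))
  refine hS _ (K.zpow_mem hK (-m)) ?_
  have h1 := hRS.2.1.conj_mem _ hn d⁻¹
  convert h1 using 1
  have h2 : (d⁻¹ * c ^ 2 * d) ^ (-m) = d⁻¹ * (c ^ 2) ^ (-m) * d⁻¹⁻¹ := by
    rw [← conj_zpow, inv_inv]
  rw [h2, ← zpow_natCast c, ← zpow_mul, hm, zpow_add, Nat.cast_ofNat, mul_neg, zpow_neg]
  group

/-! ### The presentation of the amalgamated product, and transfer of separability to it. -/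

/-- The homomorphism of the amalgamated product to `G` determined by `ιA` and `ιB`. -/
noncomputable def amalgamToG : Amalgam φ →* G :=
  QuotientGroup.lift (amalgamKernel φ) (Monoid.Coprod.lift ιA ιB) (by
    refine Subgroup.normalClosure_le_normal ?_
    rintro _ ⟨h, rfl⟩
    change Monoid.Coprod.lift ιA ιB _ = 1
    rw [map_mul, map_inv, Monoid.Coprod.lift_apply_inl, Monoid.Coprod.lift_apply_inr, ιA_eq_ιB_φ,
      mul_inv_cancel])

theorem amalgamToG_inl (x : A) : amalgamToG (Amalgam.inl φ x) = ιA x :=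
  Monoid.Coprod.lift_apply_inl ιA ιB x

theorem amalgamToG_inr (x : B) : amalgamToG (Amalgam.inr φ x) = ιB x :=
  Monoid.Coprod.lift_apply_inr ιA ιB x

theorem Amalgam.inl_eq_inr {A B : Type*} [Group A] [Group B] {H : Subgroup A} {K : Subgroup B}
    (φ : H ≃* K) (h : H) : Amalgam.inl φ h = Amalgam.inr φ (φ h) := by
  rw [← mul_inv_eq_one, ← map_inv]
  refine (QuotientGroup.eq_one_iff _).2 (Subgroup.subset_normalClosure ⟨h, ?_⟩)
  simp

/-- The images in the amalgamated product of the generators of `G`. -/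
noncomputable def genAmalgam : Gen → Amalgam φ
  | Gen.a => Amalgam.inl φ a
  | Gen.b => Amalgam.inl φ b
  | Gen.c => Amalgam.inr φ c
  | Gen.d => Amalgam.inr φ d

/-- The homomorphism of `G` to the amalgamated product. -/
noncomputable def gToAmalgam : G →* Amalgam φ :=
  PresentedGroup.toGroup (f := genAmalgam) (by
    rintro r (rfl | rfl)
    · have h := Amalgam.inl_eq_inr φ ⟨a, a_mem_H⟩
      rw [(φ_generators a_mem_H conj_a_mem_H).1] at h
      rw [map_mul, map_inv, mul_inv_eq_one, FreeGroup.lift_apply_of, FreeGroup.lift_apply_of]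
      exact h
    · have h := Amalgam.inl_eq_inr φ ⟨b⁻¹ * a * b, conj_a_mem_H⟩
      rw [(φ_generators a_mem_H conj_a_mem_H).2] at h
      rw [map_mul, map_inv, mul_inv_eq_one]
      simpa [genAmalgam] using h)

/-- `G` is the free product of `A` and `B` with amalgamated subgroups. -/
noncomputable def amalgamEquiv : Amalgam φ ≃* G :=
  MonoidHom.toMulEquiv amalgamToG gToAmalgam
    (by
      apply QuotientGroup.monoidHom_ext
      apply Monoid.Coprod.hom_ext
      · ext1 i
        change gToAmalgam (amalgamToG (Amalgam.inl φ (FreeGroup.of i))) =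
          Amalgam.inl φ (FreeGroup.of i)
        rw [amalgamToG_inl]
        fin_cases i <;> simp [ιA, gToAmalgam, PresentedGroup.toGroup.of, genAmalgam, a, b]
      · ext1 i
        change gToAmalgam (amalgamToG (Amalgam.inr φ (FreeGroup.of i))) =
          Amalgam.inr φ (FreeGroup.of i)
        rw [amalgamToG_inr]
        fin_cases i <;> simp [ιB, gToAmalgam, PresentedGroup.toGroup.of, genAmalgam, c, d])
    (by
      apply PresentedGroup.ext
      intro x
      cases x <;> simp [gToAmalgam, PresentedGroup.toGroup.of, genAmalgam, amalgamToG_inl,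
        amalgamToG_inr, ιA, ιB, a, b, c, d])

end Families

theorem ProClosed.of_finitelySeparable {Γ : Type*} [Group Γ] {F : Subgroup Γ}
    (h : FinitelySeparable F) : ProClosed (F : Set Γ) := by
  intro g hg
  obtain ⟨X, _, _, ψ, -, hψ⟩ := h g hg
  refine ⟨ψ.ker, inferInstance, inferInstance, fun s hs hm => hψ ⟨s, hs, ?_⟩⟩
  rwa [MonoidHom.mem_ker, map_mul, map_inv, inv_mul_eq_one] at hm

theorem CyclicSeparableOutsideLambda.of_mulEquiv {A B G G' : Type*} [Group A] [Group B]
    [Group G] [Group G'] {H : Subgroup A} {K : Subgroup B} {φ : H ≃* K} {i : A →* G}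
    {j : B →* G} {i' : A →* G'} {j' : B →* G'} (e : G' ≃* G) (hi : ∀ x, e (i' x) = i x)
    (hj : ∀ y, e (j' y) = j y) (h : CyclicSeparableOutsideLambda φ i j) :
    CyclicSeparableOutsideLambda φ i' j' := by
  intro F hF hconj
  have key : ∀ E : Subgroup G', ConjSubgroups (F.map e.toMonoidHom) (E.map e.toMonoidHom) →
      ConjSubgroups F E := by
    rintro E ⟨g, hg⟩
    refine ⟨e.symm g, Subgroup.map_injective (f := e.toMonoidHom) e.injective ?_⟩
    rw [hg, Subgroup.map_map, Subgroup.map_map]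
    congr 1
    ext x
    simp
  have hi' : ∀ E : Subgroup A, (E.map i').map e.toMonoidHom = E.map i := fun E => by
    rw [Subgroup.map_map]; congr 1; ext x; exact hi x
  have hj' : ∀ E : Subgroup B, (E.map j').map e.toMonoidHom = E.map j := fun E => by
    rw [Subgroup.map_map]; congr 1; ext x; exact hj x
  have h1 := h (F.map e.toMonoidHom)
    (isCyclic_of_surjective _ (F.equivMapOfInjective e.toMonoidHom e.injective).surjective) (by
      rintro _ (⟨E, hE, rfl⟩ | ⟨E, hE, rfl⟩) hc
      · exact hconj _ (Or.inl ⟨E, hE, rfl⟩) (key _ (by rwa [hi']))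
      · exact hconj _ (Or.inr ⟨E, hE, rfl⟩) (key _ (by rwa [hj'])))
  have h2 := (ProClosed.of_finitelySeparable h1).preimage e.toMonoidHom
  apply ProClosed.finitelySeparable
  rwa [Subgroup.coe_map, Set.preimage_image_eq _ (f := e.toMonoidHom) e.injective] at h2

end CycSep

theorem theorem2p1 :
    -- `G` is the free product of `A` and `B` with `H` and `K` amalgamated according to `φ`
    (∃ e : Amalgam φ ≃* G,
      (∀ x : A, e (Amalgam.inl φ x) = ιA x) ∧ (∀ y : B, e (Amalgam.inr φ y) = ιB y)) ∧
    CyclicSeparableOutsideLambda φ ιA ιB ∧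
    (LambdaA φ).Nonempty ∧
    (LambdaB φ).Nonempty ∧
    (∀ F : Subgroup A, F ∈ LambdaA φ ↔
      ∃ k : ℤ, k ≠ 0 ∧ ConjSubgroups F (Subgroup.zpowers (a ^ (2 * k)))) ∧
    (∀ F : Subgroup B, F ∈ LambdaB φ ↔
      ∃ k : ℤ, k ≠ 0 ∧ ConjSubgroups F (Subgroup.zpowers (c ^ (2 * k)))) ∧
    ¬ IsFiltrationFor (OmegaB φ) K ∧
    -- the filtration hypothesis is not necessary for the separability conclusion
    ¬ (∀ (A' B' : Type) [Group A'] [Group B'] (H' : Subgroup A') (K' : Subgroup B')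
        (φ' : H' ≃* K'),
      CyclicSeparableOutsideLambda φ' (Amalgam.inl φ') (Amalgam.inr φ') →
        IsFiltrationFor (OmegaA φ') H' ∧ IsFiltrationFor (OmegaB φ') K') := by
  have hA : ∀ k : ℤ, k ≠ 0 → Subgroup.zpowers (a ^ (2 * k)) ∈ LambdaA φ := fun k hk =>
    (mem_LambdaA_iff _).2 ⟨k, hk, conjSubgroups_refl _⟩
  have hB : ∀ k : ℤ, k ≠ 0 → Subgroup.zpowers (c ^ (2 * k)) ∈ LambdaB φ := fun k hk =>
    (mem_LambdaB_iff _).2 ⟨k, hk, conjSubgroups_refl _⟩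
  refine ⟨⟨amalgamEquiv, amalgamToG_inl, amalgamToG_inr⟩, cyclicSeparableOutsideLambda,
    ⟨_, hA 1 one_ne_zero⟩, ⟨_, hB 1 one_ne_zero⟩, mem_LambdaA_iff, mem_LambdaB_iff,
    not_isFiltrationFor_OmegaB, fun h => not_isFiltrationFor_OmegaB ?_⟩
  exact (h A B H K φ (cyclicSeparableOutsideLambda.of_mulEquiv amalgamEquiv amalgamToG_inl
    amalgamToG_inr)).2
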